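/- Let $\Gamma$ be a compact metric graph, not necessarily connected: finitely many vertices and finitely many edges $e\cong[0,L_e]$ with $0<L_e<\infty$; loops and multiple edges are allowed. Let $V$ be a real potential in $L^2(\Gamma)=\bigoplus_e L^2(0,L_e)$. For a vertex $v$, let $\mathcal E_v$ be the set of edge ends attached to $v$ (a loop at $v$ contributes both of its ends), $d_v=|\mathcal E_v|$, and for $f\in\bigoplus_e H^2(0,L_e)$ let $F(v),F'(v)\in\mathbb C^{\mathcal E_v}$ be the vectors of the values of $f$ and of the derivatives of $f$ at $v$ along the edge ends in $\mathcal E_v$, derivatives being taken from the vertex into the edge. The Hamiltonian $\mathcal H$ of $\Gamma$ acts in $L^2(\Gamma)$ as $f\mapsto -f''+Vf$ on each edge, on the domain of all complex-valued $f\in\bigoplus_e H^2(0,L_e)$ that satisfy a given condition at each vertex. A condition at $v$ is called self-adjoint if it has the form $A_vF(v)+B_vF'(v)=0$ with $d_v\times d_v$ complex matrices such that $(A_v\,B_v)$ has rank $d_v$ and $A_vB_v^*$ is self-adjoint. The $\delta$-type condition with constant $\alpha\in\mathbb R$ at $v$ is: $f$ is continuous at $v$ (all entries of $F(v)$ are equal,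 to $f(v)$) and $\sum_{b\in\mathcal E_v}F'(v)_b=\alpha f(v)$. Let $v_0\neq v_1$ be vertices of $\Gamma$, each with at least one edge attached, endowed with the $\delta$-type conditions with constants $\alpha_0,\alpha_1\in\mathbb R$, and let arbitrary self-adjoint conditions be given at all other vertices. Let $\Gamma'$ be the graph obtained from $\Gamma$ by gluing $v_0$ and $v_1$ together into a single vertex $v$, so that $\mathcal E_v=\mathcal E_{v_0}\cup\mathcal E_{v_1}$, endowed with the $\delta$-type condition with constant $\alpha_0+\alpha_1$; the edges, their lengths, the potential and the conditions at the other vertices are unchanged. Then the eigenvalues of the Hamiltonian of $\Gamma$, and likewise those of the Hamiltonian of $\Gamma'$, are all real and can be listed in non-decreasing order, each repeated according to its (finite) multiplicity, as infinite sequences $\lambda_1(\Gamma)\le\lambda_2(\Gamma)\le\dots$ and $\lambda_1(\Gamma')\le\lambda_2(\Gamma')\le\dots$, and for all $n\ge 1$ \[ \lambda_n(\Gamma)\;\le\;\lambda_n(\Gamma')\;\le\;\lambda_{n+1}(\Gamma). \] -/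

import Mathlib

open MeasureTheory

noncomputable section

/-- A (linear, local) vertex condition at a vertex whose set of incident edge ends is `ι`: the
subspace of admissible pairs `(F, F')`, where `F` collects the values of a function at the vertex
along the incident edge ends and `F'` the derivatives taken from the vertex into the edges. -/
abbrev VertexCondition (ι : Type*) := Submodule ℂ ((ι → ℂ) × (ι → ℂ))

namespace VertexCondition

/-- A vertex condition is self-adjoint if it has the form `A F + B F' = 0` with square matrices
`A`, `B` such that the `d × 2d` matrix `(A B)` has maximal rank and `A B*` is self-adjoint. -/
def IsSelfAdjoint {ι : Type*} [Fintype ι] (M : VertexCondition ι) : Prop :=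
  ∃ A B : Matrix ι ι ℂ,
    (Matrix.fromCols A B).rank = Fintype.card ι ∧
    (A * B.conjTranspose).IsHermitian ∧
    ∀ F F' : ι → ℂ, (F, F') ∈ M ↔ A.mulVec F + B.mulVec F' = 0

/-- The δ-type condition with constant `α`: the function is continuous at the vertex, and the sum
of the derivatives into the edges equals `α` times the value at the vertex. -/
def delta (ι : Type*) [Fintype ι] (α : ℝ) : VertexCondition ι where
  carrier := {p | (∀ b c, p.1 b = p.1 c) ∧ ∀ b, ∑ c, p.2 c = (α : ℂ) * p.1 b}
  zero_mem' := by simp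
  add_mem' := by
    rintro p q ⟨hp, hp'⟩ ⟨hq, hq'⟩
    refine ⟨fun b c => ?_, fun b => ?_⟩
    · simp only [Prod.fst_add, Pi.add_apply, hp b c, hq b c]
    · simp only [Prod.fst_add, Prod.snd_add, Pi.add_apply, Finset.sum_add_distrib, hp' b, hq' b]
      ring
  smul_mem' := by
    rintro z p ⟨hp, hp'⟩
    refine ⟨fun b c => ?_, fun b => ?_⟩
    · simp only [Prod.smul_fst, Pi.smul_apply, hp b c]
    · simp only [Prod.smul_fst, Prod.smul_snd, Pi.smul_apply, smul_eq_mul, ← Finset.mul_sum, hp' b]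
      ring

/-- Transport of a vertex condition along a map of index sets: `(F, F')` is admissible
if its restriction along `i` is. -/
def transport {ι κ : Type*} (i : ι → κ) (M : VertexCondition ι) : VertexCondition κ :=
  M.comap ((LinearMap.funLeft ℂ ℂ i).prodMap (LinearMap.funLeft ℂ ℂ i))

end VertexCondition

/-- `u` belongs to the Sobolev space `H²(0, L)`, with first derivative `u'` and second derivative
`u''`: on `[0, L]`, `u` is a primitive of `u'`, and `u'` is a primitive of the `L²` function `u''`.
In particular `u` and `u'` are the continuous representatives, so that their values at the
endpoints of `[0, L]` are the Sobolev traces. -/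
structure IsSobolevH2 (L : ℝ) (u u' u'' : ℝ → ℂ) : Prop where
  memLp : MemLp u'' 2 (volume.restrict (Set.Icc 0 L))
  deriv_eq : ∀ x ∈ Set.Icc 0 L, u' x = u' 0 + ∫ t in (0 : ℝ)..x, u'' t
  eq : ∀ x ∈ Set.Icc 0 L, u x = u 0 + ∫ t in (0 : ℝ)..x, u' t

namespace IsSobolevH2

variable {L : ℝ} {u u' u'' w w' w'' : ℝ → ℂ}

theorem intervalIntegrable_snd (h : IsSobolevH2 L u u' u'') {x : ℝ} (hx : x ∈ Set.Icc 0 L) :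
    IntervalIntegrable u'' volume 0 x := by
  have h1 : IntegrableOn u'' (Set.Icc 0 L) volume := h.memLp.integrable (by norm_num)
  rw [intervalIntegrable_iff_integrableOn_Icc_of_le hx.1]
  exact h1.mono_set (Set.Icc_subset_Icc_right hx.2)

theorem continuousOn_fst (h : IsSobolevH2 L u u' u'') : ContinuousOn u' (Set.Icc 0 L) := by
  have h1 : IntegrableOn u'' (Set.Icc 0 L) volume := h.memLp.integrable (by norm_num)
  have h2 := intervalIntegral.continuousOn_primitive_Icc h1
  refine (continuousOn_const.add h2).congr (f := fun x => u' 0 + ∫ t in Set.Icc 0 x, u'' t) ?_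
  intro x hx
  show u' x = u' 0 + ∫ t in Set.Icc 0 x, u'' t
  rw [h.deriv_eq x hx, intervalIntegral.integral_of_le hx.1, integral_Icc_eq_integral_Ioc]

theorem intervalIntegrable_fst (h : IsSobolevH2 L u u' u'') {x : ℝ} (hx : x ∈ Set.Icc 0 L) :
    IntervalIntegrable u' volume 0 x := by
  refine ContinuousOn.intervalIntegrable ?_
  rw [Set.uIcc_of_le hx.1]
  exact h.continuousOn_fst.mono (Set.Icc_subset_Icc_right hx.2)

theorem zero (L : ℝ) : IsSobolevH2 L 0 0 0 :=
  ⟨MemLp.zero, by simp, by simp⟩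

theorem add (h : IsSobolevH2 L u u' u'') (k : IsSobolevH2 L w w' w'') :
    IsSobolevH2 L (u + w) (u' + w') (u'' + w'') where
  memLp := h.memLp.add k.memLp
  deriv_eq x hx := by
    simp only [Pi.add_apply]
    rw [intervalIntegral.integral_add (h.intervalIntegrable_snd hx) (k.intervalIntegrable_snd hx),
      h.deriv_eq x hx, k.deriv_eq x hx]
    ring
  eq x hx := by
    simp only [Pi.add_apply]
    rw [intervalIntegral.integral_add (h.intervalIntegrable_fst hx) (k.intervalIntegrable_fst hx),
      h.eq x hx, k.eq x hx]
    ring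

theorem smul (z : ℂ) (h : IsSobolevH2 L u u' u'') : IsSobolevH2 L (z • u) (z • u') (z • u'') where
  memLp := h.memLp.const_smul z
  deriv_eq x hx := by
    simp only [Pi.smul_apply, smul_eq_mul]
    rw [intervalIntegral.integral_const_mul, h.deriv_eq x hx]
    ring
  eq x hx := by
    simp only [Pi.smul_apply, smul_eq_mul]
    rw [intervalIntegral.integral_const_mul, h.eq x hx]
    ring

end IsSobolevH2

/-- A compact metric graph with vertex set `V` and edge set `E` (loops, multiple edges and several
components allowed), a real potential in `L²` on its edges, and a condition at every vertex.
The edge `e` is the segment `[0, length e]`; its ends are `(e, false)` (at `x = 0`) and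
`(e, true)` (at `x = length e`), and `vert` gives the vertex at which an edge end is attached. -/
structure QuantumGraph (V E : Type*) where
  vert : E × Bool → V
  length : E → ℝ
  length_pos : ∀ e, 0 < length e
  potential : E → ℝ → ℝ
  potential_memLp : ∀ e, MemLp (potential e) 2 (volume.restrict (Set.Icc 0 (length e)))
  cond : ∀ v, VertexCondition {b : E × Bool // vert b = v}

namespace QuantumGraph

variable {V E : Type*}

/-- The edge ends incident to the vertex `v` (a loop at `v` contributes both of its ends). -/
abbrev EndsAt (Γ : QuantumGraph V E) (v : V) : Type _ := {b : E × Bool // Γ.vert b = v}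

/-- The Lebesgue measure on the edge `e`. -/
abbrev edgeMeasure (Γ : QuantumGraph V E) (e : E) : Measure ℝ :=
  volume.restrict (Set.Icc 0 (Γ.length e))

/-- The Hilbert space `L²(Γ)`, the orthogonal direct sum of the spaces `L²(e)`. -/
abbrev L2 (Γ : QuantumGraph V E) : Type _ := PiLp 2 (fun e : E => Lp ℂ 2 (Γ.edgeMeasure e))

/-- The value of `u` at an edge end. -/
def endValue (Γ : QuantumGraph V E) (u : E → ℝ → ℂ) (b : E × Bool) : ℂ :=
  if b.2 then u b.1 (Γ.length b.1) else u b.1 0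

/-- The derivative at an edge end, taken into the edge; `u'` is the derivative with respect
to the coordinate `x` of the edge. -/
def endDeriv (Γ : QuantumGraph V E) (u' : E → ℝ → ℂ) (b : E × Bool) : ℂ :=
  if b.2 then -u' b.1 (Γ.length b.1) else u' b.1 0

/-- The Hamiltonian `f ↦ -f'' + V f` of the quantum graph, as the graph of an unbounded operator
in `L²(Γ)`: the set of pairs `(f, g)` such that `f` is in `H²` on every edge, satisfies all the
vertex conditions, and `g = -f'' + V f`. -/
def hamiltonian [Fintype E] (Γ : QuantumGraph V E) : Submodule ℂ (Γ.L2 × Γ.L2) where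
  carrier := {p | ∃ u u' u'' : E → ℝ → ℂ,
    (∀ e, IsSobolevH2 (Γ.length e) (u e) (u' e) (u'' e)) ∧
    (∀ e, p.1 e =ᵐ[Γ.edgeMeasure e] u e) ∧
    (∀ e, p.2 e =ᵐ[Γ.edgeMeasure e] fun x => -u'' e x + (Γ.potential e x : ℂ) * u e x) ∧
    ∀ v, ((fun b : Γ.EndsAt v => Γ.endValue u b), fun b : Γ.EndsAt v => Γ.endDeriv u' b)
      ∈ Γ.cond v}
  zero_mem' := by
    refine ⟨0, 0, 0, fun e => IsSobolevH2.zero _, fun e => ?_, fun e => ?_, fun v => ?_⟩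
    · exact Lp.coeFn_zero ℂ 2 (Γ.edgeMeasure e)
    · filter_upwards [Lp.coeFn_zero ℂ 2 (Γ.edgeMeasure e)] with x hx
      simpa using hx
    · convert (Γ.cond v).zero_mem using 1
      ext b <;> simp [endValue, endDeriv]
  add_mem' := by
    rintro p q ⟨u, u', u'', h1, h2, h3, h4⟩ ⟨w, w', w'', k1, k2, k3, k4⟩
    refine ⟨u + w, u' + w', u'' + w'', fun e => (h1 e).add (k1 e), fun e => ?_, fun e => ?_,
      fun v => ?_⟩
    · filter_upwards [Lp.coeFn_add (p.1 e) (q.1 e), h2 e, k2 e] with x hx hp hq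
      simp only [Prod.fst_add, PiLp.add_apply, Pi.add_apply] at hx ⊢
      rw [hx, hp, hq]
    · filter_upwards [Lp.coeFn_add (p.2 e) (q.2 e), h3 e, k3 e] with x hx hp hq
      simp only [Prod.snd_add, PiLp.add_apply, Pi.add_apply] at hx ⊢
      rw [hx, hp, hq]
      ring
    · convert (Γ.cond v).add_mem (h4 v) (k4 v) using 1
      refine Prod.ext (funext fun b => ?_) (funext fun b => ?_)
      · simp only [endValue, Prod.fst_add, Pi.add_apply]
        split_ifs <;> rfl
      · simp only [endDeriv, Prod.snd_add, Pi.add_apply]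
        split_ifs <;> ring
  smul_mem' := by
    rintro z p ⟨u, u', u'', h1, h2, h3, h4⟩
    refine ⟨z • u, z • u', z • u'', fun e => (h1 e).smul z, fun e => ?_, fun e => ?_,
      fun v => ?_⟩
    · filter_upwards [Lp.coeFn_smul z (p.1 e), h2 e] with x hx hp
      simp only [Prod.smul_fst, PiLp.smul_apply, Pi.smul_apply] at hx ⊢
      rw [hx, hp]
    · filter_upwards [Lp.coeFn_smul z (p.2 e), h3 e] with x hx hp
      simp only [Prod.smul_snd, PiLp.smul_apply, Pi.smul_apply, smul_eq_mul] at hx ⊢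
      rw [hx, hp]
      ring
    · convert (Γ.cond v).smul_mem z (h4 v) using 1
      refine Prod.ext (funext fun b => ?_) (funext fun b => ?_)
      · simp only [endValue, Prod.smul_fst, Pi.smul_apply]
        split_ifs <;> rfl
      · simp only [endDeriv, Prod.smul_snd, Pi.smul_apply, smul_eq_mul]
        split_ifs <;> ring

/-- The space of all `f` in the domain of the Hamiltonian with `H f = μ f`. -/
def eigenspace [Fintype E] (Γ : QuantumGraph V E) (μ : ℂ) : Submodule ℂ Γ.L2 :=
  Γ.hamiltonian.comap (LinearMap.id.prod (μ • LinearMap.id))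

/-- `l 0 ≤ l 1 ≤ l 2 ≤ …` is the list of all eigenvalues of the Hamiltonian in non-decreasing
order, each eigenvalue being repeated according to its multiplicity. -/
def IsEigenvalueSequence [Fintype E] (Γ : QuantumGraph V E) (l : ℕ → ℝ) : Prop :=
  Monotone l ∧
    ∀ μ : ℂ, {n : ℕ | (l n : ℂ) = μ}.encard = Cardinal.toENat (Module.rank ℂ (Γ.eigenspace μ))

/-- The map of vertex sets that glues `v₁` to `v₀`; the vertex set after gluing is
`V \ {v₁}`, and its element `v₀` is the glued vertex. -/
def glueMap [DecidableEq V] (v₀ v₁ : V) (h : v₀ ≠ v₁) (v : V) : {v : V // v ≠ v₁} :=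
  if hv : v = v₁ then ⟨v₀, h⟩ else ⟨v, hv⟩

theorem glueMap_coe [DecidableEq V] (v₀ v₁ : V) (h : v₀ ≠ v₁) (w : {v : V // v ≠ v₁}) :
    glueMap v₀ v₁ h w.1 = w := by
  simp [glueMap, w.2]

/-- The quantum graph obtained by gluing the vertices `v₀` and `v₁` into a single vertex endowed
with the δ-type condition with constant `α`. Edges, lengths and potential are unchanged, and so
are the conditions at all the other vertices (whose sets of incident edge ends do not change). -/
def glue [DecidableEq V] [Fintype E] (Γ : QuantumGraph V E) (v₀ v₁ : V) (h : v₀ ≠ v₁) (α : ℝ) :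
    QuantumGraph {v : V // v ≠ v₁} E where
  vert b := glueMap v₀ v₁ h (Γ.vert b)
  length := Γ.length
  length_pos := Γ.length_pos
  potential := Γ.potential
  potential_memLp := Γ.potential_memLp
  cond w :=
    if w.1 = v₀ then VertexCondition.delta _ α
    else VertexCondition.transport
      (fun b : Γ.EndsAt w.1 =>
        ⟨b.1, (congrArg (glueMap v₀ v₁ h) b.2).trans (glueMap_coe v₀ v₁ h w)⟩)
      (Γ.cond w.1)

end QuantumGraph

end

/-! The quadratic form of the Hamiltonian is the sum over the edges of `∫ |f'|² + V |f|²` plus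
boundary terms, and a δ-type vertex contributes `α |f(v)|²`. Where `f(v₀) = f(v₁)` the two δ-terms
add up to `(α₀ + α₁) |f(v)|²`, so the form of the glued graph is the form of the original one
restricted by a single linear constraint. The inequalities are then those of the min-max principle.

The argument is run on resolvents, so that no form domain has to be constructed. For a large common
shift `c` both operators `H + c` are positive with compact inverses `R` (for `Γ`) and `R'` (for
`Γ'`). The restriction of the form gives `R' ≤ R` (`IsSolutionOperator.re_inner_le`). If the
solution on `Γ` takes equal values at `v₀` and `v₁`, it also satisfies the glued condition, so `R`
and `R'` agree on the kernel of one functional (`IsSolutionOperator.eq_of_trace_mem`). From these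
two facts and a dimension count, `IsPositiveResolvent.interlacing` compares the inverse eigenvalues.

The resolvents come from a boundary value problem. A function in `H²` of an edge is encoded by
`(u'', u(0), u'(0))`, and `-u'' + (V + c) u = g` with the vertex conditions becomes an equation `p -
K p = (-g, 0)` with `K` compact. Uniqueness follows from positivity, existence from the Fredholm
alternative (`MetricEdges.exists_isSolutionOperator`). Positivity after a shift rests on the trace
inequality `IsSobolevH2.exists_norm_sq_le`, and symmetry on the vanishing of boundary terms for
self-adjoint conditions (`IsSelfAdjoint.isLagrangian`). The spectral theorem for compact symmetric
operators then provides the lists of eigenvalues. -/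

/-! ### Eigenvalue sequences of operators with compact positive resolvent -/

section Enumeration

/-- A real-valued function with finite sublevel sets on an infinite type can be listed in
non-decreasing order. -/
theorem exists_equiv_nat_monotone {I : Type*} [Infinite I] (f : I → ℝ)
    (hf : ∀ t, {i | f i ≤ t}.Finite) : ∃ σ : ℕ ≃ I, Monotone (f ∘ σ) := by
  have hcount : Countable I := by
    have : (Set.univ : Set I) = ⋃ n : ℕ, {i | f i ≤ n} := by
      ext i
      simpa using exists_nat_ge (f i)
    rw [← Set.countable_univ_iff, this]
    exact Set.countable_iUnion fun n => (hf n).countable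
  obtain ⟨g, hg⟩ := exists_injective_nat I
  -- Ties in `f` are broken by an injection into `ℕ`: `key` is injective with finite initial
  -- segments, and the number `r i` of predecessors of `i` embeds `I` into `ℕ` in the order of
  -- `key`.
  let key : I → ℝ ×ₗ ℕ := fun i => toLex (f i, g i)
  have hkey : Function.Injective key := fun i j h => 
    hg (congrArg Prod.snd (toLex.injective h))
  have hle : ∀ i j, key i ≤ key j → f i ≤ f j := fun i j h => by
    rw [Prod.Lex.toLex_le_toLex] at h
    rcases h with h | h
    exacts [h.le, h.1.le]
  have hfin : ∀ i, {j | key j < key i}.Finite := fun i =>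
    (hf (f i)).subset fun j hj => hle j i (le_of_lt hj)
  let r : I → ℕ := fun i => {j | key j < key i}.ncard
  have hr : ∀ i j, key i < key j → r i < r j := fun i j h => by
    refine Set.ncard_lt_ncard ⟨fun k hk => lt_trans hk h, fun hsub => ?_⟩ (hfin j)
    exact lt_irrefl (key i) (hsub h)
  have hrinj : Function.Injective r := fun i j h => by
    rcases lt_trichotomy (key i) (key j) with h' | h' | h'
    · exact absurd h (hr _ _ h').ne
    · exact hkey h'
    · exact absurd h (hr _ _ h').ne'
  let e : I ≃ Set.range r := Equiv.ofInjective r hrinj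
  have : Infinite (Set.range r) := Infinite.of_injective e e.injective
  let σ := Nat.Subtype.orderIsoOfNat (Set.range r)
  refine ⟨σ.toEquiv.trans e.symm, fun m n hmn => ?_⟩
  have h1 : σ m ≤ σ n := σ.monotone hmn
  have h2 : ∀ k, r (e.symm (σ k)) = σ k := fun k => by
    have := e.apply_symm_apply (σ k)
    exact congrArg Subtype.val this
  simp only [Function.comp, Equiv.trans_apply]
  refine hle _ _ (le_of_not_gt fun h => ?_)
  have h3 := hr _ _ h
  have h4 : (σ m : ℕ) ≤ σ n := h1
  change r (e.symm (σ n)) < r (e.symm (σ m)) at h3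
  rw [h2, h2] at h3
  omega

end Enumeration

/-! ### Compact positive resolvents: eigenbases and min-max interlacing. -/

section Spectral

open scoped InnerProductSpace

variable {H : Type*} [NormedAddCommGroup H] [InnerProductSpace ℂ H]

/-- The properties of the inverse of a positive operator with compact resolvent. -/
structure IsPositiveResolvent (R : H →L[ℂ] H) : Prop where
  compact : IsCompactOperator R
  symm : (R : H →ₗ[ℂ] H).IsSymmetric
  nonneg : ∀ x, 0 ≤ (⟪R x, x⟫_ℂ).re
  inj : ∀ x, R x = 0 → x = 0

/-- The eigenspace for the eigenvalue `μ` of the operator `R⁻¹ - c`. -/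
def shiftedEigenspace (R : H →L[ℂ] H) (c : ℝ) (μ : ℂ) : Submodule ℂ H :=
  LinearMap.ker ((LinearMap.id : H →ₗ[ℂ] H) - (μ + c) • (R : H →ₗ[ℂ] H))

theorem mem_shiftedEigenspace {R : H →L[ℂ] H} {c : ℝ} {μ : ℂ} {x : H} :
    x ∈ shiftedEigenspace R c μ ↔ x = (μ + c) • R x := by
  simp [shiftedEigenspace, LinearMap.mem_ker, sub_eq_zero]

theorem shiftedEigenspace_eq_eigenspace {R : H →L[ℂ] H} {c : ℝ} {μ : ℂ} (h : μ + c ≠ 0) :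
    shiftedEigenspace R c μ = Module.End.eigenspace (R : H →ₗ[ℂ] H) (μ + c)⁻¹ := by
  ext x
  rw [mem_shiftedEigenspace, Module.End.mem_eigenspace_iff, ContinuousLinearMap.coe_coe,
    eq_inv_smul_iff₀ h, eq_comm]

theorem shiftedEigenspace_eq_bot_of_add_eq_zero {R : H →L[ℂ] H} {c : ℝ} {μ : ℂ} (h : μ + c = 0) :
    shiftedEigenspace R c μ = ⊥ := by
  rw [eq_bot_iff]
  intro x hx
  rw [mem_shiftedEigenspace, h, zero_smul] at hx
  simpa using hx

/-- `l` lists the eigenvalues of the operator `R⁻¹ - c` in non-decreasing order, with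
multiplicity. -/
def IsShiftedEigenvalueSequence (R : H →L[ℂ] H) (c : ℝ) (l : ℕ → ℝ) : Prop :=
  Monotone l ∧ ∀ μ : ℂ, {n : ℕ | (l n : ℂ) = μ}.encard =
    Cardinal.toENat (Module.rank ℂ (shiftedEigenspace R c μ))

namespace IsPositiveResolvent

variable {R R' : H →L[ℂ] H} {c : ℝ}

theorem finiteDimensional [CompleteSpace H] (hR : IsPositiveResolvent R) (μ : ℂ) :
    FiniteDimensional ℂ (shiftedEigenspace R c μ) := by
  by_cases h : μ + c = 0
  · rw [shiftedEigenspace_eq_bot_of_add_eq_zero h]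
    infer_instance
  · rw [shiftedEigenspace_eq_eigenspace h]
    exact ContinuousLinearMap.finite_dimensional_eigenspace hR.compact _ (inv_ne_zero h)

theorem pos_of_mem (hR : IsPositiveResolvent R) {t : ℝ} {x : H} (hx : x = (t : ℂ) • R x)
    (hx0 : x ≠ 0) : 0 < t := by
  by_contra h
  have h1 : (⟪x, x⟫_ℂ).re = t * (⟪R x, x⟫_ℂ).re := by
    nth_rewrite 1 [hx]
    rw [inner_smul_left]
    simp
  have h2 : 0 < (⟪x, x⟫_ℂ).re := by
    have : (⟪x, x⟫_ℂ).re = ‖x‖ ^ 2 := inner_self_eq_norm_sq (𝕜 := ℂ) x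
    rw [this]
    positivity
  have := mul_nonpos_of_nonpos_of_nonneg (not_lt.1 h) (hR.nonneg x)
  linarith

/-- Eigenvalues of the symmetric operator `R` are real, hence so is `μ`. This is why a real sequence
can account for the eigenspaces at all complex `μ`. -/
theorem shiftedEigenspace_eq_bot (hR : IsPositiveResolvent R) {μ : ℂ} (h : μ.im ≠ 0) :
    shiftedEigenspace R c μ = ⊥ := by
  have h0 : μ + c ≠ 0 := fun h' => h (by simpa using congrArg Complex.im h')
  rw [shiftedEigenspace_eq_eigenspace h0]
  by_contra hne
  have h1 := hR.symm.conj_eigenvalue_eq_self (Module.End.hasEigenvalue_iff.2 hne)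
  rw [map_inv₀, inv_inj, Complex.conj_eq_iff_im] at h1
  exact h (by simpa using h1)

theorem inner_eq_zero_of_ne (hR : IsPositiveResolvent R) {s t : ℝ} (hst : s ≠ t) {x y : H}
    (hx : x ∈ shiftedEigenspace R c s) (hy : y ∈ shiftedEigenspace R c t) : ⟪x, y⟫_ℂ = 0 := by
  by_cases hs : (s : ℂ) + c = 0
  · rw [shiftedEigenspace_eq_bot_of_add_eq_zero hs, Submodule.mem_bot] at hx
    simp [hx]
  by_cases ht : (t : ℂ) + c = 0
  · rw [shiftedEigenspace_eq_bot_of_add_eq_zero ht, Submodule.mem_bot] at hy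
    simp [hy]
  rw [shiftedEigenspace_eq_eigenspace hs] at hx
  rw [shiftedEigenspace_eq_eigenspace ht] at hy
  refine hR.symm.orthogonalFamily_eigenspaces (i := ((s : ℂ) + c)⁻¹) (j := ((t : ℂ) + c)⁻¹)
    (fun h => hst ?_) ⟨x, hx⟩ ⟨y, hy⟩
  rw [inv_inj, add_left_inj] at h
  exact_mod_cast h

/-- A family of reals that takes every value as often as its multiplicity as an eigenvalue of
`R⁻¹ - c` comes from an orthonormal basis of eigenvectors. -/
theorem exists_hilbertBasis [CompleteSpace H] (hR : IsPositiveResolvent R) {I : Type*} (f : I → ℝ)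
    (hf : ∀ μ : ℝ, Nonempty (Fin (Module.finrank ℂ (shiftedEigenspace R c μ)) ≃ {i // f i = μ})) :
    ∃ b : HilbertBasis I ℂ H,
      (∀ i, 0 < f i + c) ∧ ∀ i, R (b i) = (((f i + c)⁻¹ : ℝ) : ℂ) • b i := by
  have hfd : ∀ μ : ℂ, FiniteDimensional ℂ (shiftedEigenspace R c μ) := hR.finiteDimensional
  let _ : ∀ μ : ℝ, Fintype {i // f i = μ} := fun μ => Fintype.ofEquiv _ (hf μ).some
  let e : ∀ μ : ℝ, OrthonormalBasis {i // f i = μ} ℂ (shiftedEigenspace R c μ) := fun μ =>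
    (stdOrthonormalBasis ℂ (shiftedEigenspace R c μ)).reindex (hf μ).some
  let v : I → H := fun i => e (f i) ⟨i, rfl⟩
  have hve : ∀ (μ : ℝ) (i : {i // f i = μ}), v i = e μ i := by
    rintro μ ⟨i, rfl⟩
    rfl
  have hmem : ∀ i, v i ∈ shiftedEigenspace R c (f i) := fun i => (e (f i) ⟨i, rfl⟩).2
  have horth : Orthonormal ℂ v := by
    constructor
    · intro i
      exact (e (f i)).orthonormal.1 ⟨i, rfl⟩
    · intro i j hij
      by_cases h : f i = f j
      · have h1 := hve (f j) ⟨i, h⟩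
        have h2 := (e (f j)).orthonormal.2 (i := ⟨i, h⟩) (j := ⟨j, rfl⟩) (by simpa using hij)
        change ⟪v i, v j⟫_ℂ = 0
        rw [h1]
        exact h2
      · exact hR.inner_eq_zero_of_ne h (hmem i) (hmem j)
  have hspan : ∀ μ : ℝ, shiftedEigenspace R c μ ≤ Submodule.span ℂ (Set.range v) := by
    intro μ x hx
    have h1 : (⟨x, hx⟩ : shiftedEigenspace R c μ) ∈
        Submodule.span ℂ (Set.range (e μ).toBasis) := (e μ).toBasis.mem_span _
    have h2 := Submodule.mem_map_of_mem (f := (shiftedEigenspace R c μ).subtype) h1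
    rw [Submodule.map_span] at h2
    refine Submodule.span_mono ?_ h2
    rintro _ ⟨_, ⟨i, rfl⟩, rfl⟩
    exact ⟨i, by simpa using hve μ i⟩
  -- The eigenspaces of a compact symmetric operator have dense sum. The eigenvalue `0` is excluded
  -- by injectivity, and a nonzero eigenvalue `s` of `R` corresponds to `μ = s⁻¹ - c`, which is real
  -- or has trivial eigenspace.
  have hbot : (Submodule.span ℂ (Set.range v))ᗮ = ⊥ := by
    rw [eq_bot_iff, ← ContinuousLinearMap.orthogonalComplement_iSup_eigenspaces_eq_bot
      hR.compact hR.symm]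
    refine Submodule.orthogonal_le (iSup_le fun s => ?_)
    by_cases hs : s = 0
    · intro x hx
      rw [Module.End.mem_eigenspace_iff, hs, zero_smul] at hx
      rw [hR.inj x hx]
      exact zero_mem _
    have h1 : Module.End.eigenspace (R : H →ₗ[ℂ] H) s = shiftedEigenspace R c (s⁻¹ - c) := by
      rw [shiftedEigenspace_eq_eigenspace (by simpa using hs)]
      simp
    rw [h1]
    by_cases him : (s⁻¹ - (c : ℂ)).im = 0
    · have h2 : s⁻¹ - (c : ℂ) = ((s⁻¹ - (c : ℂ)).re : ℝ) := Complex.ext rfl (by simpa using him)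
      rw [h2]
      exact hspan _
    · rw [hR.shiftedEigenspace_eq_bot him]
      exact bot_le
  have hv0 : ∀ i, v i ≠ 0 := horth.ne_zero
  have heq : ∀ i, v i = ((f i + c : ℝ) : ℂ) • R (v i) := fun i => by
    have := mem_shiftedEigenspace.1 (hmem i)
    simpa using this
  have hpos : ∀ i, 0 < f i + c := fun i => hR.pos_of_mem (heq i) (hv0 i)
  refine ⟨HilbertBasis.mkOfOrthogonalEqBot horth hbot, hpos, fun i => ?_⟩
  rw [HilbertBasis.coe_mkOfOrthogonalEqBot, Complex.ofReal_inv, eq_inv_smul_iff₀, ← heq]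
  exact_mod_cast (hpos i).ne'

/-- Parseval's identity, with `R` diagonal in the basis `b`. -/
theorem hasSum_inner (hR : IsPositiveResolvent R) {I : Type*} (b : HilbertBasis I ℂ H) {s : I → ℝ}
    (hb : ∀ i, R (b i) = (s i : ℂ) • b i) (x : H) :
    HasSum (fun i => s i * ‖⟪b i, x⟫_ℂ‖ ^ 2) (⟪R x, x⟫_ℂ).re := by
  have h := Complex.hasSum_re (b.hasSum_inner_mul_inner (R x) x)
  refine h.congr_fun fun i => ?_
  have h1 : ⟪R x, b i⟫_ℂ = s i * ⟪x, b i⟫_ℂ := by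
    have := hR.symm x (b i)
    simp only [ContinuousLinearMap.coe_coe] at this
    rw [this, hb, inner_smul_right]
  rw [h1, mul_assoc, ← inner_conj_symm x (b i), Complex.conj_mul']
  norm_cast

theorem _root_.HilbertBasis.hasSum_norm_sq {I : Type*} (b : HilbertBasis I ℂ H) (x : H) :
    HasSum (fun i => ‖⟪b i, x⟫_ℂ‖ ^ 2) (‖x‖ ^ 2) := by
  have h := Complex.hasSum_re (b.hasSum_inner_mul_inner x x)
  have h2 : (⟪x, x⟫_ℂ).re = ‖x‖ ^ 2 := inner_self_eq_norm_sq (𝕜 := ℂ) x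
  rw [h2] at h
  refine h.congr_fun fun i => ?_
  rw [← inner_conj_symm x (b i), Complex.conj_mul']
  norm_cast

/-- The bound on `s i` is required only where `x` has a nonzero coefficient, so that it applies to
vectors in the span of some basis vectors or orthogonal to others. -/
theorem inner_le (hR : IsPositiveResolvent R) {I : Type*} (b : HilbertBasis I ℂ H) {s : I → ℝ}
    (hb : ∀ i, R (b i) = (s i : ℂ) • b i) {x : H} {t : ℝ}
    (hx : ∀ i, ⟪b i, x⟫_ℂ ≠ 0 → s i ≤ t) : (⟪R x, x⟫_ℂ).re ≤ t * ‖x‖ ^ 2 := by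
  refine hasSum_le (fun i => ?_) (hR.hasSum_inner b hb x) ((b.hasSum_norm_sq x).mul_left t)
  by_cases h : ⟪b i, x⟫_ℂ = 0
  · simp [h]
  · exact mul_le_mul_of_nonneg_right (hx i h) (by positivity)

theorem le_inner (hR : IsPositiveResolvent R) {I : Type*} (b : HilbertBasis I ℂ H) {s : I → ℝ}
    (hb : ∀ i, R (b i) = (s i : ℂ) • b i) {x : H} {t : ℝ}
    (hx : ∀ i, ⟪b i, x⟫_ℂ ≠ 0 → t ≤ s i) : t * ‖x‖ ^ 2 ≤ (⟪R x, x⟫_ℂ).re := by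
  refine hasSum_le (fun i => ?_) ((b.hasSum_norm_sq x).mul_left t) (hR.hasSum_inner b hb x)
  by_cases h : ⟪b i, x⟫_ℂ = 0
  · simp [h]
  · exact mul_le_mul_of_nonneg_right (hx i h) (by positivity)

/-- The eigenvalues of a compact operator do not accumulate away from zero. -/
theorem _root_.IsCompactOperator.finite_setOf_le {R : H →L[ℂ] H} (hR : IsCompactOperator R)
    {I : Type*} {v : I → H}
    (hv : Orthonormal ℂ v) {s : I → ℝ} (hb : ∀ i, R (v i) = (s i : ℂ) • v i) {t : ℝ} (ht : 0 < t) :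
    {i | t ≤ s i}.Finite := by
  by_contra hinf
  rw [← Set.Infinite] at hinf
  obtain ⟨K, hK, hsub⟩ := hR.image_closedBall_subset_compact (σ₁₂ := RingHom.id ℂ)
    (f := (R : H →ₗ[ℂ] H)) 1
  -- Pairing `R (v i) - R (v j)` with the unit vector `v i` gives `s i`, so the images are
  -- `t`-separated, which an infinite subset of a compact set cannot be.
  have hdist : ∀ i ∈ {i | t ≤ s i}, ∀ j ∈ {i | t ≤ s i}, i ≠ j → t ≤ dist (R (v i)) (R (v j)) := by
    intro i hi j hj hij
    have h1 : ⟪v i, R (v i) - R (v j)⟫_ℂ = s i := by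
      have e1 : ⟪v i, v i⟫_ℂ = 1 := by
        rw [inner_self_eq_norm_sq_to_K, hv.1 i]
        simp
      rw [hb, hb, inner_sub_right, inner_smul_right, inner_smul_right, hv.2 hij, e1]
      simp
    have h2 := norm_inner_le_norm (𝕜 := ℂ) (v i) (R (v i) - R (v j))
    rw [h1, hv.1 i, one_mul, Complex.norm_real, Real.norm_of_nonneg (ht.le.trans hi)] at h2
    rw [dist_eq_norm]
    exact le_trans hi h2
  have hinj : Set.InjOn (fun i => R (v i)) {i | t ≤ s i} := by
    intro i hi j hj h
    by_contra hij
    have := hdist i hi j hj hij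
    simp only at h
    rw [h, dist_self] at this
    linarith
  obtain ⟨x, -, hx⟩ := (hinf.image hinj).exists_accPt_of_subset_isCompact hK (by
    rintro _ ⟨i, -, rfl⟩
    exact hsub ⟨v i, by simp [hv.1 i], rfl⟩)
  rw [accPt_iff_frequently] at hx
  have hball : ∀ᶠ y in nhds x, dist y x < t / 2 := Metric.ball_mem_nhds x (by linarith)
  -- The second image is taken strictly closer to the accumulation point than the first, which makes
  -- the two indices distinct; both lie within `t / 2` of it.
  obtain ⟨_, ⟨hy1, ⟨i, hi, rfl⟩⟩, hy2⟩ := (hx.and_eventually hball).exists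
  have hpos : 0 < dist (R (v i)) x := dist_pos.2 hy1
  obtain ⟨_, ⟨hz1, ⟨j, hj, rfl⟩⟩, hz2⟩ :=
    (hx.and_eventually (Metric.ball_mem_nhds x hpos)).exists
  have hz3 : dist (R (v j)) x < dist (R (v i)) x := hz2
  simp only at hy2
  have hij : i ≠ j := fun h => by
    rw [h] at hz3
    exact lt_irrefl _ hz3
  have := hdist i hi j hj hij
  have := dist_triangle_right (R (v i)) (R (v j)) x
  linarith

/-- Existence of the list of eigenvalues. -/
theorem exists_isShiftedEigenvalueSequence [CompleteSpace H] (hR : IsPositiveResolvent R)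
    (hH : ¬ FiniteDimensional ℂ H) (c : ℝ) : ∃ l, IsShiftedEigenvalueSequence R c l := by
  have hfd : ∀ μ : ℂ, FiniteDimensional ℂ (shiftedEigenspace R c μ) := hR.finiteDimensional
  -- One index for each real `μ` and each vector of a basis of its eigenspace; almost all fibres
  -- turn out to be empty.
  let I := Σ μ : ℝ, Fin (Module.finrank ℂ (shiftedEigenspace R c μ))
  let f : I → ℝ := Sigma.fst
  let eqv : ∀ μ : ℝ, Fin (Module.finrank ℂ (shiftedEigenspace R c μ)) ≃ {i : I // f i = μ} :=
    fun μ => (Equiv.sigmaSubtype (β := fun μ : ℝ =>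
      Fin (Module.finrank ℂ (shiftedEigenspace R c μ))) μ).symm
  obtain ⟨b, hpos, hb⟩ := hR.exists_hilbertBasis f fun μ => ⟨eqv μ⟩
  have : Infinite I := by
    by_contra hfin
    rw [not_infinite_iff_finite] at hfin
    have := Fintype.ofFinite I
    exact hH b.toOrthonormalBasis.toBasis.finiteDimensional_of_finite
  have hsub : ∀ t, {i | f i ≤ t}.Finite := by
    intro t
    by_cases htc : 0 < t + c
    · refine (hR.compact.finite_setOf_le b.orthonormal hb (inv_pos.2 htc)).subset fun i hi => ?_
      have hi' : f i ≤ t := hi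
      exact inv_anti₀ (hpos i) (by linarith)
    · convert Set.finite_empty
      ext i
      have := hpos i
      simp only [Set.mem_ofPred_eq, Set.mem_empty_iff_false, iff_false]
      intro h
      linarith
  obtain ⟨σ, hσ⟩ := exists_equiv_nat_monotone f hsub
  refine ⟨f ∘ σ, hσ, fun μ => ?_⟩
  by_cases him : μ.im = 0
  · obtain ⟨r, rfl⟩ : ∃ r : ℝ, μ = r := ⟨μ.re, Complex.ext rfl (by simpa using him)⟩
    have h1 : {n : ℕ | ((f ∘ σ) n : ℂ) = r} = σ ⁻¹' {i | f i = r} := by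
      ext n
      simp
    rw [h1, ← Module.finrank_eq_rank, Cardinal.toENat_nat,
      Set.encard_preimage_of_bijective σ.bijective, Set.encard]
    have h2 := ENat.card_congr (eqv r)
    rw [ENat.card_eq_coe_fintype_card, Fintype.card_fin] at h2
    exact h2.symm
  · have h1 : {n : ℕ | ((f ∘ σ) n : ℂ) = μ} = ∅ := by
      ext n
      simp only [Set.mem_ofPred_eq, Set.mem_empty_iff_false, iff_false]
      rintro rfl
      simp at him
    rw [h1, hR.shiftedEigenspace_eq_bot him]
    simp

theorem exists_hilbertBasis_nat [CompleteSpace H] (hR : IsPositiveResolvent R) {l : ℕ → ℝ}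
    (hl : IsShiftedEigenvalueSequence R c l) :
    ∃ b : HilbertBasis ℕ ℂ H,
      (∀ i, 0 < l i + c) ∧ ∀ i, R (b i) = (((l i + c)⁻¹ : ℝ) : ℂ) • b i := by
  refine hR.exists_hilbertBasis l fun μ => ?_
  have := hR.finiteDimensional (c := c) (μ : ℂ)
  have h := hl.2 μ
  rw [← Module.finrank_eq_rank, Cardinal.toENat_nat] at h
  have h1 : {n : ℕ | (l n : ℂ) = μ} = {n | l n = μ} := by
    ext n
    simp
  rw [h1] at h
  have h2 : ENat.card {n // l n = μ} = (Module.finrank ℂ (shiftedEigenspace R c μ) : ℕ) := h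
  have : Finite {n // l n = μ} := ENat.card_lt_top.1 (by rw [h2]; exact ENat.natCast_lt_top _)
  rw [ENat.card_eq_coe_natCard] at h2
  exact ⟨(Finite.equivFinOfCardEq (by exact_mod_cast h2)).symm⟩

/-- A nonzero combination of `m` vectors of an orthonormal basis can be chosen to satisfy fewer
than `m` linear conditions. -/
theorem _root_.HilbertBasis.exists_ne_zero (b : HilbertBasis ℕ ℂ H) {m k : ℕ} (hkm : k < m)
    (φ : H →ₗ[ℂ] (Fin k → ℂ)) :
    ∃ x : H, x ≠ 0 ∧ φ x = 0 ∧ ∀ i, ⟪b i, x⟫_ℂ ≠ 0 → i < m := by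
  let L : (Fin m → ℂ) →ₗ[ℂ] H := Fintype.linearCombination ℂ fun i : Fin m => b i
  have hker : LinearMap.ker (φ ∘ₗ L) ≠ ⊥ := LinearMap.ker_ne_bot_of_finrank_lt (by simpa using hkm)
  obtain ⟨a, ha, ha0⟩ := Submodule.exists_mem_ne_zero_of_ne_bot hker
  have hli : LinearIndependent ℂ fun i : Fin m => b i :=
    b.orthonormal.linearIndependent.comp _ Fin.val_injective
  refine ⟨L a, fun h => ha0 ?_, ha, fun i hi => ?_⟩
  · rw [Fintype.linearIndependent_iff] at hli
    ext i
    exact hli a (by simpa [L, Fintype.linearCombination_apply] using h) i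
  · by_contra him
    refine hi ?_
    rw [Fintype.linearCombination_apply, inner_sum]
    refine Finset.sum_eq_zero fun j _ => ?_
    rw [inner_smul_right, b.orthonormal.2 (fun h => him (by rw [h]; exact j.2)), mul_zero]

/-- Interlacing of eigenvalues for resolvents that are ordered and differ by an operator of
rank at most one. -/
theorem interlacing [CompleteSpace H] (hR : IsPositiveResolvent R) (hR' : IsPositiveResolvent R')
    (hle : ∀ x, (⟪R' x, x⟫_ℂ).re ≤ (⟪R x, x⟫_ℂ).re) (φ : H →ₗ[ℂ] ℂ)
    (hφ : ∀ x, φ x = 0 → R x = R' x) {l l' : ℕ → ℝ}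
    (hl : IsShiftedEigenvalueSequence R c l) (hl' : IsShiftedEigenvalueSequence R' c l') (n : ℕ) :
    l n ≤ l' n ∧ l' n ≤ l (n + 1) := by
  obtain ⟨b, hpos, hb⟩ := hR.exists_hilbertBasis_nat hl
  obtain ⟨b', hpos', hb'⟩ := hR'.exists_hilbertBasis_nat hl'
  have key : ∀ {s t : ℝ}, 0 < s + c → 0 < t + c → (t + c)⁻¹ ≤ (s + c)⁻¹ → s ≤ t := by
    intro s t hs ht h
    have := (inv_le_inv₀ ht hs).1 h
    linarith
  constructor
  -- Indices start at `0`: `x` lies in the span of `b' 0, …, b' n` and is orthogonal to `b 0, …, b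
  -- (n - 1)`, which is `n` conditions in dimension `n + 1`.
  · let φ₁ : H →ₗ[ℂ] (Fin n → ℂ) := LinearMap.pi fun i => innerₛₗ ℂ (b i)
    obtain ⟨x, hx0, hx1, hx2⟩ := b'.exists_ne_zero (Nat.lt_succ_self n) φ₁
    have hx : 0 < ‖x‖ ^ 2 := by positivity
    have h1 : (l' n + c)⁻¹ * ‖x‖ ^ 2 ≤ (⟪R' x, x⟫_ℂ).re := hR'.le_inner b' hb' fun i hi =>
      inv_anti₀ (hpos' i) (by linarith [hl'.1 (Nat.lt_succ_iff.1 (hx2 i hi))])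
    have h2 : (⟪R x, x⟫_ℂ).re ≤ (l n + c)⁻¹ * ‖x‖ ^ 2 := hR.inner_le b hb fun i hi => by
      refine inv_anti₀ (hpos n) ?_
      have : n ≤ i := by
        by_contra hin
        exact hi (congrFun hx1 ⟨i, not_le.1 hin⟩)
      linarith [hl.1 this]
    exact key (hpos n) (hpos' n) (le_of_mul_le_mul_right (h1.trans ((hle x).trans h2)) hx)
  -- Here `x` lies in the span of `b 0, …, b (n + 1)`, is orthogonal to `b' 0, …, b' (n - 1)` and
  -- satisfies `φ x = 0`: `n + 1` conditions in dimension `n + 2`. The extra condition is what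
  -- shifts the index by one.
  · let φ₁ : H →ₗ[ℂ] (Fin (n + 1) → ℂ) :=
      LinearMap.pi (Fin.cons φ fun i : Fin n => innerₛₗ ℂ (b' i))
    obtain ⟨x, hx0, hx1, hx2⟩ := b.exists_ne_zero (Nat.lt_succ_self (n + 1)) φ₁
    have hx : 0 < ‖x‖ ^ 2 := by positivity
    have hRR : R x = R' x := hφ x (by simpa [φ₁] using congrFun hx1 0)
    have h1 : (l (n + 1) + c)⁻¹ * ‖x‖ ^ 2 ≤ (⟪R x, x⟫_ℂ).re := hR.le_inner b hb fun i hi =>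
      inv_anti₀ (hpos i) (by linarith [hl.1 (Nat.lt_succ_iff.1 (hx2 i hi))])
    have h2 : (⟪R' x, x⟫_ℂ).re ≤ (l' n + c)⁻¹ * ‖x‖ ^ 2 := hR'.inner_le b' hb' fun i hi => by
      refine inv_anti₀ (hpos' n) ?_
      have : n ≤ i := by
        by_contra hin
        exact hi (congrFun hx1 (Fin.succ ⟨i, not_le.1 hin⟩))
      linarith [hl'.1 this]
    rw [hRR] at h1
    exact key (hpos' n) (hpos (n + 1)) (le_of_mul_le_mul_right (h1.trans h2) hx)

end IsPositiveResolvent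

end Spectral

/-! ### Calculus of Sobolev functions on an interval -/

section Interval

open Set intervalIntegral

open scoped ComplexConjugate

theorem absolutelyContinuousOnInterval_integral_complex {f : ℝ → ℂ} {a b : ℝ}
    (hf : IntervalIntegrable f volume a b) :
    AbsolutelyContinuousOnInterval (fun x => ∫ t in a..x, f t) a b := by
  have hre : IntervalIntegrable (fun t => (f t).re) volume a b := ⟨hf.1.re, hf.2.re⟩
  have him : IntervalIntegrable (fun t => (f t).im) volume a b := ⟨hf.1.im, hf.2.im⟩
  have h1 := hre.absolutelyContinuousOnInterval_intervalIntegral (c := a) left_mem_uIcc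
  have h2 := him.absolutelyContinuousOnInterval_intervalIntegral (c := a) left_mem_uIcc
  have hc : ∀ z : ℂ, AbsolutelyContinuousOnInterval (fun _ : ℝ => z) a b := fun z =>
    ((LipschitzWith.const z).lipschitzOnWith (s := uIcc a b)).absolutelyContinuousOnInterval
  have h3 := (h1.fun_smul (hc 1)).fun_add (h2.fun_smul (hc Complex.I))
  -- The splitting into real and imaginary parts is available only on the interval, so absolute
  -- continuity is transferred through its ε-δ form, which involves only points there.
  rw [absolutelyContinuousOnInterval_iff] at h3 ⊢
  intro ε hε
  obtain ⟨δ, hδ, h⟩ := h3 ε hε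
  refine ⟨δ, hδ, fun E hE hlt => ?_⟩
  have key : ∀ x ∈ uIcc a b, (∫ t in a..x, f t) =
      (∫ t in a..x, (f t).re) • (1 : ℂ) + (∫ t in a..x, (f t).im) • Complex.I := by
    intro x hx
    have hfx : IntervalIntegrable f volume a x := hf.mono_set (uIcc_subset_uIcc_left hx)
    have hrex : IntervalIntegrable (fun t => (f t).re) volume a x :=
      hre.mono_set (uIcc_subset_uIcc_left hx)
    have himx : IntervalIntegrable (fun t => (f t).im) volume a x :=
      him.mono_set (uIcc_subset_uIcc_left hx)
    rw [← intervalIntegral.integral_smul_const, ← intervalIntegral.integral_smul_const,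
      ← intervalIntegral.integral_add]
    · refine intervalIntegral.integral_congr fun t _ => ?_
      simp [Complex.re_add_im]
    · exact ⟨hrex.1.smul_const _, hrex.2.smul_const _⟩
    · exact ⟨himx.1.smul_const _, himx.2.smul_const _⟩
  have := h E hE hlt
  convert this using 1
  refine Finset.sum_congr rfl fun i hi => ?_
  have hmem := hE.1 i hi
  rw [key _ hmem.1, key _ hmem.2]

/-- Integration by parts for primitives of integrable functions. -/
theorem integral_mul_add_mul_eq_sub {f f' g g' : ℝ → ℂ} {L : ℝ} (hL : 0 ≤ L)
    (hf' : IntervalIntegrable f' volume 0 L) (hg' : IntervalIntegrable g' volume 0 L)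
    (hf : ∀ x ∈ Icc 0 L, f x = f 0 + ∫ t in (0 : ℝ)..x, f' t)
    (hg : ∀ x ∈ Icc 0 L, g x = g 0 + ∫ t in (0 : ℝ)..x, g' t) :
    ∫ t in (0 : ℝ)..L, (f' t * g t + f t * g' t) = f L * g L - f 0 * g 0 := by
  have hc : ∀ z : ℂ, AbsolutelyContinuousOnInterval (fun _ : ℝ => z) 0 L := fun z =>
    ((LipschitzWith.const z).lipschitzOnWith (s := uIcc 0 L)).absolutelyContinuousOnInterval
  -- `f` and `g` are controlled only on `[0, L]`; they are replaced by primitives defined on the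
  -- whole line.
  let F : ℝ → ℂ := fun x => f 0 + ∫ t in (0 : ℝ)..x, f' t
  let G : ℝ → ℂ := fun x => g 0 + ∫ t in (0 : ℝ)..x, g' t
  have hF : AbsolutelyContinuousOnInterval F 0 L :=
    (hc _).fun_add (absolutelyContinuousOnInterval_integral_complex hf')
  have hG : AbsolutelyContinuousOnInterval G 0 L :=
    (hc _).fun_add (absolutelyContinuousOnInterval_integral_complex hg')
  have hint : IntervalIntegrable (fun t => f' t * G t + F t * g' t) volume 0 L :=
    (hf'.mul_continuousOn hG.continuousOn).add (hg'.continuousOn_mul hF.continuousOn)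
  -- `D` is absolutely continuous with derivative zero almost everywhere, hence constant; comparing
  -- its values at `0` and `L` gives the formula.
  let D : ℝ → ℂ := fun x => F x * G x - ∫ t in (0 : ℝ)..x, (f' t * G t + F t * g' t)
  have hD : AbsolutelyContinuousOnInterval D 0 L :=
    (hF.fun_smul hG).fun_sub (absolutelyContinuousOnInterval_integral_complex hint)
  have hD0 : ∀ᵐ x, x ∈ uIcc 0 L → HasDerivAt D 0 x := by
    filter_upwards [hf'.ae_hasDerivAt_integral, hg'.ae_hasDerivAt_integral,
      hint.ae_hasDerivAt_integral] with x h1 h2 h3 hx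
    have k1 : HasDerivAt F (f' x) x := (h1 hx 0 left_mem_uIcc).const_add _
    have k2 : HasDerivAt G (g' x) x := (h2 hx 0 left_mem_uIcc).const_add _
    have k3 := (k1.mul k2).sub (h3 hx 0 left_mem_uIcc)
    rw [sub_self] at k3
    exact k3
  obtain ⟨C, hC⟩ := hD.const_of_ae_hasDerivAt_zero hD0
  have e1 := hC 0 left_mem_uIcc
  have e2 := hC L right_mem_uIcc
  have e3 : ∫ t in (0 : ℝ)..L, (f' t * g t + f t * g' t) =
      ∫ t in (0 : ℝ)..L, (f' t * G t + F t * g' t) := by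
    refine intervalIntegral.integral_congr fun t ht => ?_
    rw [uIcc_of_le hL] at ht
    simp only [F, G, ← hf t ht, ← hg t ht]
  have e4 : F L = f L := (hf L ⟨hL, le_rfl⟩).symm
  have e5 : G L = g L := (hg L ⟨hL, le_rfl⟩).symm
  have e6 : F 0 = f 0 := by simp [F]
  have e7 : G 0 = g 0 := by simp [G]
  have e8 : D 0 = f 0 * g 0 := by simp [D, e6, e7]
  have e9 : D L = f L * g L - ∫ t in (0 : ℝ)..L, (f' t * G t + F t * g' t) := by
    simp only [D, e4, e5]
  rw [e3]
  rw [e8] at e1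
  rw [e9, ← e1] at e2
  linear_combination -e2

/-- Lebesgue differentiation: at almost every interior point the primitive has derivative `f x`,
while it vanishes nearby. -/
theorem ae_eq_zero_of_integral_eq_zero {f : ℝ → ℂ} {L : ℝ} (hL : 0 ≤ L)
    (hf : IntervalIntegrable f volume 0 L)
    (h : ∀ x ∈ Icc 0 L, ∫ t in (0 : ℝ)..x, f t = 0) : f =ᵐ[volume.restrict (Icc 0 L)] 0 := by
  have h1 : ∀ᵐ x : ℝ, x ≠ 0 := by simp [ae_iff, measure_singleton]
  have h2 : ∀ᵐ x : ℝ, x ≠ L := by simp [ae_iff, measure_singleton]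
  refine (ae_restrict_iff' measurableSet_Icc).2 ?_
  filter_upwards [hf.ae_hasDerivAt_integral, h1, h2] with x hx hx0 hxL hxI
  have k1 := hx (by rwa [uIcc_of_le hL]) 0 left_mem_uIcc
  have k2 : HasDerivAt (fun x => ∫ t in (0 : ℝ)..x, f t) 0 x := by
    refine (hasDerivAt_const x (0 : ℂ)).congr_of_eventuallyEq ?_
    filter_upwards [Icc_mem_nhds (lt_of_le_of_ne hxI.1 (Ne.symm hx0))
      (lt_of_le_of_ne hxI.2 hxL)] with y hy
    exact h y hy
  exact k1.unique k2

/-- The Cauchy–Schwarz inequality for the integral of a norm. -/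
theorem sq_integral_norm_le {f : ℝ → ℂ} {a b : ℝ} (hab : a ≤ b) (hf : ContinuousOn f (Icc a b)) :
    (∫ t in a..b, ‖f t‖) ^ 2 ≤ (b - a) * ∫ t in a..b, ‖f t‖ ^ 2 := by
  rcases hab.eq_or_lt with rfl | hlt
  · simp
  set A := ∫ t in a..b, ‖f t‖ with hA
  have hpos : 0 < b - a := sub_pos.2 hlt
  -- `m` is the mean of `‖f‖`; the inequality says that its variance is nonnegative.
  set m := A / (b - a) with hm
  have hfn : ContinuousOn (fun t => ‖f t‖) (uIcc a b) := by rw [uIcc_of_le hab]; exact hf.norm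
  have i1 : IntervalIntegrable (fun t => ‖f t‖) volume a b := hfn.intervalIntegrable
  have i2 : IntervalIntegrable (fun t => ‖f t‖ ^ 2) volume a b := (hfn.pow 2).intervalIntegrable
  have h0 : 0 ≤ ∫ t in a..b, (‖f t‖ - m) ^ 2 :=
    intervalIntegral.integral_nonneg hab fun t _ => sq_nonneg _
  have h1 : ∫ t in a..b, (‖f t‖ - m) ^ 2 =
      (∫ t in a..b, ‖f t‖ ^ 2) - 2 * m * A + m ^ 2 * (b - a) := by
    have : (fun t => (‖f t‖ - m) ^ 2) = fun t => (‖f t‖ ^ 2 - 2 * m * ‖f t‖) + m ^ 2 := by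
      ext t
      ring
    rw [this, intervalIntegral.integral_add (i2.sub (i1.const_mul _)) intervalIntegrable_const,
      intervalIntegral.integral_sub i2 (i1.const_mul _), intervalIntegral.integral_const_mul,
      intervalIntegral.integral_const, smul_eq_mul]
    ring
  have h2 : m * (b - a) = A := div_mul_cancel₀ A hpos.ne'
  rw [h1] at h0
  nlinarith [h0, h2]

namespace IsSobolevH2

variable {L : ℝ} {u u' u'' v v' v'' : ℝ → ℂ}

theorem continuousOn (h : IsSobolevH2 L u u' u'') : ContinuousOn u (Icc 0 L) := by
  have h1 : IntegrableOn u' (Icc 0 L) volume := h.continuousOn_fst.integrableOn_Icc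
  have h2 := intervalIntegral.continuousOn_primitive_Icc h1
  refine (continuousOn_const.add h2).congr (f := fun x => u 0 + ∫ t in Icc 0 x, u' t) ?_
  intro x hx
  change u x = u 0 + ∫ t in Icc 0 x, u' t
  rw [h.eq x hx, intervalIntegral.integral_of_le hx.1, integral_Icc_eq_integral_Ioc]

/-- Green's formula. -/
theorem green (hL : 0 ≤ L) (h : IsSobolevH2 L u u' u'') (k : IsSobolevH2 L v v' v'') :
    ∫ t in (0 : ℝ)..L, -u'' t * conj (v t) = (∫ t in (0 : ℝ)..L, u' t * conj (v' t)) +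
      (u' 0 * conj (v 0) + -u' L * conj (v L)) := by
  have hmem : L ∈ Icc 0 L := ⟨hL, le_rfl⟩
  have i1 := h.intervalIntegrable_snd hmem
  have i2 : IntervalIntegrable (fun t => conj (v' t)) volume 0 L := by
    refine ContinuousOn.intervalIntegrable ?_
    rw [uIcc_of_le hL]
    exact Complex.continuous_conj.comp_continuousOn k.continuousOn_fst
  have hg : ∀ x ∈ Icc 0 L, conj (v x) = conj (v 0) + ∫ t in (0 : ℝ)..x, conj (v' t) := by
    intro x hx
    rw [k.eq x hx, map_add, intervalIntegral.integral_of_le hx.1,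
      intervalIntegral.integral_of_le hx.1, integral_conj]
  have hcv : ContinuousOn (fun t => conj (v t)) (uIcc 0 L) := by
    rw [uIcc_of_le hL]
    exact Complex.continuous_conj.comp_continuousOn k.continuousOn
  have hcu : ContinuousOn u' (uIcc 0 L) := by
    rw [uIcc_of_le hL]
    exact h.continuousOn_fst
  have key := integral_mul_add_mul_eq_sub (g := fun x => conj (v x)) hL i1 i2 h.deriv_eq hg
  rw [intervalIntegral.integral_add (i1.mul_continuousOn hcv) (i2.continuousOn_mul hcu)] at key
  simp only [neg_mul, intervalIntegral.integral_neg]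
  linear_combination -key

/-- Hölder continuity of exponent `1/2`, from Cauchy–Schwarz applied to `u'` between the two points.
-/
theorem norm_sub_sq_le (h : IsSobolevH2 L u u' u'') {x y : ℝ} (hx : x ∈ Icc 0 L)
    (hy : y ∈ Icc 0 L) : ‖u x - u y‖ ^ 2 ≤ |x - y| * ∫ t in (0 : ℝ)..L, ‖u' t‖ ^ 2 := by
  wlog hxy : y ≤ x generalizing x y
  · rw [norm_sub_rev, abs_sub_comm]
    exact this hy hx (le_of_not_ge hxy)
  have hL : 0 ≤ L := hx.1.trans hx.2
  have e1 : u x - u y = ∫ t in y..x, u' t := by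
    rw [h.eq x hx, h.eq y hy, add_sub_add_left_eq_sub, intervalIntegral.integral_interval_sub_left
      (h.intervalIntegrable_fst hx) (h.intervalIntegrable_fst hy)]
  have hsub : Icc y x ⊆ Icc 0 L := Icc_subset_Icc hy.1 hx.2
  have e2 : ‖u x - u y‖ ≤ ∫ t in y..x, ‖u' t‖ := by
    rw [e1]
    exact intervalIntegral.norm_integral_le_integral_norm hxy
  have e3 := sq_integral_norm_le hxy (h.continuousOn_fst.mono hsub)
  have hi : IntervalIntegrable (fun t => ‖u' t‖ ^ 2) volume 0 L := by
    refine ContinuousOn.intervalIntegrable ?_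
    rw [uIcc_of_le hL]
    exact h.continuousOn_fst.norm.pow 2
  have e4 : ∫ t in y..x, ‖u' t‖ ^ 2 ≤ ∫ t in (0 : ℝ)..L, ‖u' t‖ ^ 2 :=
    intervalIntegral.integral_mono_interval hy.1 hxy hx.2
      (Filter.Eventually.of_forall fun t => sq_nonneg _) hi
  rw [abs_of_nonneg (sub_nonneg.2 hxy)]
  calc ‖u x - u y‖ ^ 2 ≤ (∫ t in y..x, ‖u' t‖) ^ 2 := by gcongr
    _ ≤ (x - y) * ∫ t in y..x, ‖u' t‖ ^ 2 := e3
    _ ≤ _ := mul_le_mul_of_nonneg_left e4 (sub_nonneg.2 hxy)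

/-- The trace inequality. -/
theorem exists_norm_sq_le (hL : 0 < L) {ε : ℝ} (hε : 0 < ε) :
    ∃ C, ∀ u u' u'' : ℝ → ℂ, IsSobolevH2 L u u' u'' → ∀ x ∈ Icc 0 L,
      ‖u x‖ ^ 2 ≤ ε * (∫ t in (0 : ℝ)..L, ‖u' t‖ ^ 2) + C * ∫ t in (0 : ℝ)..L, ‖u t‖ ^ 2 := by
  -- `δ` is the length of a window in `[0, L]` containing `x`. Averaging `‖u x‖² ≤ 2 ‖u y‖² + 2 δ D`
  -- over `y` in the window gives the factors `2 δ ≤ ε` and `2 / δ`.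
  set δ := min L (ε / 2) with hδdef
  have hδ : 0 < δ := lt_min hL (by linarith)
  have hδL : δ ≤ L := min_le_left _ _
  have hδε : 2 * δ ≤ ε := by linarith [min_le_right L (ε / 2)]
  refine ⟨2 / δ, fun u u' u'' h x hx => ?_⟩
  set D := ∫ t in (0 : ℝ)..L, ‖u' t‖ ^ 2 with hD
  set N := ∫ t in (0 : ℝ)..L, ‖u t‖ ^ 2 with hN
  have hD0 : 0 ≤ D := intervalIntegral.integral_nonneg hL.le fun t _ => sq_nonneg _
  -- The window is `[a, a + δ]`, pushed to the left when `x` is too close to `L`.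
  set a := min x (L - δ) with ha
  have ha0 : 0 ≤ a := le_min hx.1 (by linarith)
  have haL : a + δ ≤ L := by linarith [min_le_right x (L - δ)]
  have hax : a ≤ x := min_le_left _ _
  have hxa : x ≤ a + δ := by
    rcases min_choice x (L - δ) with h' | h' <;> rw [← ha] at h' <;> linarith [hx.2]
  have hcont : ContinuousOn (fun t => ‖u t‖ ^ 2) (uIcc 0 L) := by
    rw [uIcc_of_le hL.le]
    exact h.continuousOn.norm.pow 2
  have hi : IntervalIntegrable (fun t => ‖u t‖ ^ 2) volume 0 L := hcont.intervalIntegrable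
  have hi' : IntervalIntegrable (fun t => ‖u t‖ ^ 2) volume a (a + δ) :=
    hi.mono_set (by
      rw [uIcc_of_le hL.le, uIcc_of_le (by linarith)]
      exact Icc_subset_Icc ha0 haL)
  have hpt : ∀ y ∈ Icc a (a + δ), ‖u x‖ ^ 2 ≤ 2 * ‖u y‖ ^ 2 + 2 * δ * D := by
    intro y hy
    have e1 := h.norm_sub_sq_le hx (y := y) ⟨ha0.trans hy.1, hy.2.trans haL⟩
    have e2 : |x - y| ≤ δ := abs_le.2 ⟨by linarith [hy.2], by linarith [hy.1]⟩
    have e3 : ‖u x‖ ≤ ‖u y‖ + ‖u x - u y‖ := by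
      have := norm_add_le (u y) (u x - u y)
      simpa using this
    have e4 : |x - y| * D ≤ δ * D := mul_le_mul_of_nonneg_right e2 hD0
    nlinarith [norm_nonneg (u x), sq_nonneg (‖u y‖ - ‖u x - u y‖), norm_nonneg (u y),
      norm_nonneg (u x - u y)]
  have hint : ∫ _ in a..(a + δ), ‖u x‖ ^ 2 ≤ ∫ y in a..(a + δ), (2 * ‖u y‖ ^ 2 + 2 * δ * D) :=
    intervalIntegral.integral_mono_on (by linarith) intervalIntegrable_const
      ((hi'.const_mul 2).add intervalIntegrable_const) hpt
  rw [intervalIntegral.integral_const, intervalIntegral.integral_add (hi'.const_mul 2)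
    intervalIntegrable_const, intervalIntegral.integral_const, intervalIntegral.integral_const_mul,
    add_sub_cancel_left, smul_eq_mul, smul_eq_mul] at hint
  have hmono : ∫ y in a..(a + δ), ‖u y‖ ^ 2 ≤ N :=
    intervalIntegral.integral_mono_interval ha0 (by linarith) haL
      (Filter.Eventually.of_forall fun t => sq_nonneg _) hi
  have hfin : δ * ‖u x‖ ^ 2 ≤ δ * (2 * δ * D + 2 / δ * N) := by
    have : δ * (2 * δ * D + 2 / δ * N) = 2 * N + δ * (2 * δ * D) := by field_simp; ring
    rw [this]
    linarith
  have h1 := le_of_mul_le_mul_left hfin hδ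
  have h2 : 2 * δ * D ≤ ε * D := mul_le_mul_of_nonneg_right hδε hD0
  linarith

/-- Lower bound for the quadratic form of a Schrödinger operator on an interval. -/
theorem exists_form_bound (hL : 0 < L) {q : ℝ → ℝ} (hq : MemLp q 2 (volume.restrict (Icc 0 L)))
    {C : ℝ} (hC : 0 ≤ C) :
    ∃ c, ∀ u u' u'' : ℝ → ℂ, IsSobolevH2 L u u' u'' →
      C * (‖u 0‖ ^ 2 + ‖u L‖ ^ 2) ≤ (∫ t in (0 : ℝ)..L, ‖u' t‖ ^ 2) +
        (∫ t in (0 : ℝ)..L, q t * ‖u t‖ ^ 2) + c * ∫ t in (0 : ℝ)..L, ‖u t‖ ^ 2 := by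
  have hqi : IntervalIntegrable q volume 0 L := by
    rw [intervalIntegrable_iff_integrableOn_Icc_of_le hL.le]
    exact hq.integrable (by norm_num)
  set Q := ∫ t in (0 : ℝ)..L, |q t| with hQ
  have hQ0 : 0 ≤ Q := intervalIntegral.integral_nonneg hL.le fun t _ => abs_nonneg _
  -- The potential term is at most `Q` times the bound `S` for `‖u t‖²`, and the two endpoint terms
  -- at most `2 C` times it. This `ε` keeps the resulting multiple of `D` below `D`.
  obtain ⟨K, hK⟩ := exists_norm_sq_le hL (ε := 1 / (Q + 2 * C + 1)) (by positivity)
  refine ⟨(Q + 2 * C) * K, fun u u' u'' h => ?_⟩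
  set D := ∫ t in (0 : ℝ)..L, ‖u' t‖ ^ 2 with hD
  set N := ∫ t in (0 : ℝ)..L, ‖u t‖ ^ 2 with hN
  have hD0 : 0 ≤ D := intervalIntegral.integral_nonneg hL.le fun t _ => sq_nonneg _
  set S := 1 / (Q + 2 * C + 1) * D + K * N with hS
  have hx := hK u u' u'' h
  have h0 := hx 0 ⟨le_rfl, hL.le⟩
  have hLL := hx L ⟨hL.le, le_rfl⟩
  have hcont : ContinuousOn (fun t => ‖u t‖ ^ 2) (uIcc 0 L) := by
    rw [uIcc_of_le hL.le]
    exact h.continuousOn.norm.pow 2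
  have hpot : -(Q * S) ≤ ∫ t in (0 : ℝ)..L, q t * ‖u t‖ ^ 2 := by
    rw [hQ, ← intervalIntegral.integral_mul_const, ← intervalIntegral.integral_neg]
    refine intervalIntegral.integral_mono_on hL.le (hqi.abs.mul_const _).neg
      (hqi.mul_continuousOn hcont) fun t ht => ?_
    have e1 := hx t ht
    have e2 : |q t| * ‖u t‖ ^ 2 ≤ |q t| * S := mul_le_mul_of_nonneg_left e1 (abs_nonneg _)
    have e3 : -(|q t| * ‖u t‖ ^ 2) ≤ q t * ‖u t‖ ^ 2 := by
      rw [← neg_mul]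
      exact mul_le_mul_of_nonneg_right (neg_abs_le _) (sq_nonneg _)
    linarith
  have hQC : (Q + 2 * C) * S ≤ D + (Q + 2 * C) * K * N := by
    have e1 : (Q + 2 * C) * (1 / (Q + 2 * C + 1)) ≤ 1 := by
      rw [mul_one_div, div_le_one (by positivity)]
      linarith
    have e2 := mul_le_mul_of_nonneg_right e1 hD0
    rw [hS]
    nlinarith
  have hb : C * (‖u 0‖ ^ 2 + ‖u L‖ ^ 2) ≤ C * (S + S) :=
    mul_le_mul_of_nonneg_left (add_le_add h0 hLL) hC
  linarith

theorem eq_zero_of_eqOn_zero (hL : 0 < L) (h : IsSobolevH2 L u u' u'')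
    (hu : ∀ x ∈ Icc 0 L, u x = 0) :
    (∀ x ∈ Icc 0 L, u' x = 0) ∧ u'' =ᵐ[volume.restrict (Icc 0 L)] 0 := by
  have hmem : L ∈ Icc 0 L := ⟨hL.le, le_rfl⟩
  have h0mem : (0 : ℝ) ∈ Icc 0 L := ⟨le_rfl, hL.le⟩
  have h1 : u' =ᵐ[volume.restrict (Icc 0 L)] 0 :=
    ae_eq_zero_of_integral_eq_zero hL.le (h.intervalIntegrable_fst hmem) fun x hx => by
      have := h.eq x hx
      rw [hu x hx, hu 0 h0mem, zero_add] at this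
      exact this.symm
  have h2 := Measure.eqOn_Icc_of_ae_eq volume hL.ne h1 h.continuousOn_fst continuousOn_const
  refine ⟨fun x hx => h2 hx, ae_eq_zero_of_integral_eq_zero hL.le (h.intervalIntegrable_snd hmem)
    fun x hx => ?_⟩
  have := h.deriv_eq x hx
  rw [h2 hx, h2 h0mem] at this
  simpa using this.symm

end IsSobolevH2

end Interval

/-! ### Sobolev functions on an interval, parametrised by their second derivative and initial
values -/

noncomputable section

open Set

open scoped BoundedContinuousFunction

/-- The triples `(u'', u(0), u'(0))` that parametrise the Sobolev space `H²(0, L)`. -/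
abbrev IntervalData (L : ℝ) : Type := Lp ℂ 2 (volume.restrict (Icc 0 L)) × ℂ × ℂ

namespace IntervalData

variable {L : ℝ}

/-- The first derivative of the Sobolev function with data `p`. -/
def deriv (p : IntervalData L) (x : ℝ) : ℂ := p.2.2 + ∫ t in (0 : ℝ)..x, p.1 t

/-- The Sobolev function with data `p`. -/
def fn (p : IntervalData L) (x : ℝ) : ℂ := p.2.1 + ∫ t in (0 : ℝ)..x, p.deriv t

theorem isSobolevH2 (p : IntervalData L) : IsSobolevH2 L p.fn p.deriv p.1 where
  memLp := Lp.memLp p.1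
  deriv_eq x _ := by simp [deriv]
  eq x _ := by simp [fn]

theorem measure_Ioc_ne_top (x : ℝ) : (volume.restrict (Icc 0 L)) (Ioc 0 x) ≠ ⊤ :=
  measure_ne_top _ _

/-- The primitive at `x` is the pairing with the indicator of `(0, x]`, hence a bounded functional
on `L²`; the norm of the indicator yields the constant `√L`. -/
theorem integral_eq_inner (w : Lp ℂ 2 (volume.restrict (Icc 0 L))) {x : ℝ} (hx : x ∈ Icc 0 L) :
    ∫ t in (0 : ℝ)..x, w t =
      inner ℂ (indicatorConstLp 2 measurableSet_Ioc (measure_Ioc_ne_top (L := L) x) 1) w := by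
  rw [L2.inner_indicatorConstLp_one, Measure.restrict_restrict measurableSet_Ioc,
    intervalIntegral.integral_of_le hx.1, inter_eq_left.2]
  exact Ioc_subset_Icc_self.trans (Icc_subset_Icc_right hx.2)

/-- The derivative at a point, as a continuous linear functional of the data. -/
def derivL (L x : ℝ) : IntervalData L →L[ℂ] ℂ :=
  (ContinuousLinearMap.snd ℂ ℂ ℂ).comp (ContinuousLinearMap.snd ℂ _ _) +
    (innerSL ℂ (indicatorConstLp 2 measurableSet_Ioc (measure_Ioc_ne_top (L := L) x) 1)).comp
      (ContinuousLinearMap.fst ℂ _ _)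

theorem derivL_apply (p : IntervalData L) {x : ℝ} (hx : x ∈ Icc 0 L) :
    derivL L x p = p.deriv x := by
  rw [deriv, integral_eq_inner _ hx]
  simp [derivL]

theorem norm_deriv_le (p : IntervalData L) {x : ℝ} (hx : x ∈ Icc 0 L) :
    ‖p.deriv x‖ ≤ (1 + √L) * ‖p‖ := by
  have hL : 0 ≤ L := hx.1.trans hx.2
  have h1 : ‖p.2.2‖ ≤ ‖p‖ := (norm_snd_le p.2).trans (norm_snd_le p)
  have h2 : ‖∫ t in (0 : ℝ)..x, p.1 t‖ ≤ √L * ‖p‖ := by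
    rw [integral_eq_inner _ hx]
    refine (norm_inner_le_norm _ _).trans (mul_le_mul ?_ (norm_fst_le p) (norm_nonneg _)
      (Real.sqrt_nonneg _))
    rw [norm_indicatorConstLp (by norm_num) (by norm_num), norm_one, one_mul,
      Real.sqrt_eq_rpow, ENNReal.toReal_ofNat]
    refine Real.rpow_le_rpow measureReal_nonneg ?_ (by norm_num)
    have h3 : (volume.restrict (Icc 0 L)).real (Ioc 0 x) ≤
        (volume.restrict (Icc 0 L)).real univ := measureReal_mono (subset_univ _)
    simpa [measureReal_restrict_apply, hL] using h3
  calc ‖p.deriv x‖ ≤ ‖p.2.2‖ + ‖∫ t in (0 : ℝ)..x, p.1 t‖ := norm_add_le _ _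
    _ ≤ (1 + √L) * ‖p‖ := by linarith

theorem deriv_add (p r : IntervalData L) {x : ℝ} (hx : x ∈ Icc 0 L) :
    (p + r).deriv x = p.deriv x + r.deriv x := by
  simp only [← derivL_apply _ hx, map_add]

theorem deriv_smul (z : ℂ) (p : IntervalData L) {x : ℝ} (hx : x ∈ Icc 0 L) :
    (z • p).deriv x = z • p.deriv x := by
  simp only [← derivL_apply _ hx, map_smul]

theorem fn_add (p r : IntervalData L) {x : ℝ} (hx : x ∈ Icc 0 L) :
    (p + r).fn x = p.fn x + r.fn x := by
  have h : ∫ t in (0 : ℝ)..x, (p + r).deriv t =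
      (∫ t in (0 : ℝ)..x, p.deriv t) + ∫ t in (0 : ℝ)..x, r.deriv t := by
    rw [← intervalIntegral.integral_add (p.isSobolevH2.intervalIntegrable_fst hx)
      (r.isSobolevH2.intervalIntegrable_fst hx)]
    refine intervalIntegral.integral_congr fun t ht => ?_
    rw [uIcc_of_le hx.1] at ht
    exact deriv_add p r ⟨ht.1, ht.2.trans hx.2⟩
  rw [fn, fn, fn, h]
  simp only [Prod.snd_add, Prod.fst_add]
  ring

theorem fn_smul (z : ℂ) (p : IntervalData L) {x : ℝ} (hx : x ∈ Icc 0 L) :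
    (z • p).fn x = z • p.fn x := by
  have h : ∫ t in (0 : ℝ)..x, (z • p).deriv t = z • ∫ t in (0 : ℝ)..x, p.deriv t := by
    rw [← intervalIntegral.integral_smul]
    refine intervalIntegral.integral_congr fun t ht => ?_
    rw [uIcc_of_le hx.1] at ht
    exact deriv_smul z p ⟨ht.1, ht.2.trans hx.2⟩
  rw [fn, fn, h]
  simp [mul_add]

theorem norm_fn_sub_le (p : IntervalData L) {x y : ℝ} (hx : x ∈ Icc 0 L) (hy : y ∈ Icc 0 L) :
    ‖p.fn x - p.fn y‖ ≤ (1 + √L) * ‖p‖ * |x - y| := by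
  have h : p.fn x - p.fn y = ∫ t in y..x, p.deriv t := by
    rw [fn, fn, add_sub_add_left_eq_sub, intervalIntegral.integral_interval_sub_left
      (p.isSobolevH2.intervalIntegrable_fst hx) (p.isSobolevH2.intervalIntegrable_fst hy)]
  rw [h]
  refine intervalIntegral.norm_integral_le_of_norm_le_const fun t ht => ?_
  have ht' := uIoc_subset_uIcc ht
  exact p.norm_deriv_le ((ordConnected_Icc.uIcc_subset hy hx) ht')

theorem norm_fn_le (p : IntervalData L) {x : ℝ} (hx : x ∈ Icc 0 L) :
    ‖p.fn x‖ ≤ (1 + (1 + √L) * L) * ‖p‖ := by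
  have h0 : (0 : ℝ) ∈ Icc 0 L := ⟨le_rfl, hx.1.trans hx.2⟩
  have h1 := p.norm_fn_sub_le hx h0
  have h2 : p.fn 0 = p.2.1 := by simp [fn]
  have h3 : ‖p.2.1‖ ≤ ‖p‖ := (norm_fst_le p.2).trans (norm_snd_le p)
  have h4 : ‖p.fn x‖ ≤ ‖p.fn 0‖ + ‖p.fn x - p.fn 0‖ := by
    simpa using norm_add_le (p.fn 0) (p.fn x - p.fn 0)
  rw [h2] at h4
  rw [h2, sub_zero, abs_of_nonneg hx.1] at h1
  have h5 : (1 + √L) * ‖p‖ * x ≤ (1 + √L) * ‖p‖ * L :=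
    mul_le_mul_of_nonneg_left hx.2 (by positivity)
  linarith

/-- The Sobolev function as a bounded continuous function on `[0, L]`. -/
def fnL (hL : 0 < L) : IntervalData L →L[ℂ] (Icc 0 L →ᵇ ℂ) :=
  LinearMap.mkContinuous
    { toFun := fun p => BoundedContinuousFunction.mkOfCompact
        ⟨fun x : Icc 0 L => p.fn x,
          continuousOn_iff_continuous_domRestrict.1 p.isSobolevH2.continuousOn⟩
      map_add' := fun p r => by
        ext x
        exact fn_add p r x.2
      map_smul' := fun z p => by
        ext x
        exact fn_smul z p x.2 }
    (1 + (1 + √L) * L) fun p => by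
      rw [BoundedContinuousFunction.norm_le (by positivity)]
      exact fun x => p.norm_fn_le x.2

@[simp]
theorem fnL_apply (hL : 0 < L) (p : IntervalData L) (x : Icc 0 L) : fnL hL p x = p.fn x := rfl

/-- Functions with data in the unit ball are uniformly bounded and uniformly Lipschitz, so
Arzelà–Ascoli applies. All compactness of the resolvents stems from here. -/
theorem isCompactOperator_fnL (hL : 0 < L) : IsCompactOperator (fnL hL) := by
  refine (isCompactOperator_iff_isCompact_closure_image_closedBall
    (fnL hL : IntervalData L →ₗ[ℂ] (Icc 0 L →ᵇ ℂ)) one_pos).2 ?_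
  refine BoundedContinuousFunction.arzela_ascoli
    (Metric.closedBall (0 : ℂ) (1 + (1 + √L) * L)) (isCompact_closedBall _ _) _ ?_ ?_
  · rintro _ x ⟨p, hp, rfl⟩
    rw [mem_closedBall_zero_iff] at hp ⊢
    refine (p.norm_fn_le x.2).trans (mul_le_of_le_one_right (by positivity) hp)
  · refine (LipschitzWith.uniformEquicontinuous _ (Real.toNNReal (1 + √L)) ?_).equicontinuous
    rintro ⟨_, p, hp, rfl⟩
    rw [mem_closedBall_zero_iff] at hp
    refine LipschitzWith.of_dist_le_mul fun x y => ?_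
    rw [Real.coe_toNNReal _ (by positivity), dist_eq_norm, Subtype.dist_eq, Real.dist_eq]
    refine (p.norm_fn_sub_le x.2 y.2).trans (mul_le_mul_of_nonneg_right ?_ (abs_nonneg _))
    exact mul_le_of_le_one_right (by positivity) hp

/-- The potential is merely square integrable, so multiplication by it is defined on bounded
continuous functions and not on `L²`. -/
theorem memLp_mul_IccExtend (hL : 0 ≤ L) {q : ℝ → ℝ} (hq : MemLp q 2 (volume.restrict (Icc 0 L)))
    (φ : Icc 0 L →ᵇ ℂ) :
    MemLp (fun x => (q x : ℂ) * IccExtend hL φ x) 2 (volume.restrict (Icc 0 L)) := by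
  refine hq.of_le_mul (c := ‖φ‖) ?_ (Filter.Eventually.of_forall fun x => ?_)
  · exact (Complex.continuous_ofReal.comp_aestronglyMeasurable hq.1).mul
      (φ.continuous.Icc_extend' (h := hL)).aestronglyMeasurable
  · rw [norm_mul, mul_comm, Complex.norm_real]
    exact mul_le_mul_of_nonneg_right (φ.norm_coe_le_norm _) (norm_nonneg _)

/-- Multiplication of continuous functions by a square integrable function, as a linear map. -/
def mulLinear (hL : 0 ≤ L) {q : ℝ → ℝ} (hq : MemLp q 2 (volume.restrict (Icc 0 L))) :
    (Icc 0 L →ᵇ ℂ) →ₗ[ℂ] Lp ℂ 2 (volume.restrict (Icc 0 L)) where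
  toFun φ := (memLp_mul_IccExtend hL hq φ).toLp _
  map_add' φ ψ := by
    rw [← MemLp.toLp_add]
    refine MemLp.toLp_congr _ _ (Filter.Eventually.of_forall fun x => ?_)
    simp only [IccExtend, Function.comp, BoundedContinuousFunction.coe_add, Pi.add_apply]
    ring
  map_smul' z φ := by
    rw [RingHom.id_apply, ← MemLp.toLp_const_smul]
    refine MemLp.toLp_congr _ _ (Filter.Eventually.of_forall fun x => ?_)
    simp only [IccExtend, Function.comp, BoundedContinuousFunction.coe_smul, Pi.smul_apply,
      smul_eq_mul]
    ring

theorem mulLinear_ae_eq (hL : 0 ≤ L) {q : ℝ → ℝ} (hq : MemLp q 2 (volume.restrict (Icc 0 L)))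
    (φ : Icc 0 L →ᵇ ℂ) : mulLinear hL hq φ =ᵐ[volume.restrict (Icc 0 L)]
      fun x => (q x : ℂ) * IccExtend hL φ x :=
  (memLp_mul_IccExtend hL hq φ).coeFn_toLp

/-- Multiplication of continuous functions by a square integrable function. -/
def mulL (hL : 0 ≤ L) {q : ℝ → ℝ} (hq : MemLp q 2 (volume.restrict (Icc 0 L))) :
    (Icc 0 L →ᵇ ℂ) →L[ℂ] Lp ℂ 2 (volume.restrict (Icc 0 L)) :=
  LinearMap.mkContinuous (mulLinear hL hq) ‖hq.toLp q‖ fun φ => by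
    refine (Lp.norm_le_mul_norm_of_ae_le_mul ?_).trans_eq (mul_comm _ _)
    filter_upwards [mulLinear_ae_eq hL hq φ, hq.coeFn_toLp] with x h1 h2
    rw [h1, h2, norm_mul, mul_comm, Complex.norm_real]
    exact mul_le_mul_of_nonneg_right (φ.norm_coe_le_norm _) (norm_nonneg _)

theorem mulL_fnL_ae_eq (hL : 0 < L) {q : ℝ → ℝ} (hq : MemLp q 2 (volume.restrict (Icc 0 L)))
    (p : IntervalData L) :
    mulL hL.le hq (fnL hL p) =ᵐ[volume.restrict (Icc 0 L)] fun x => (q x : ℂ) * p.fn x := by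
  have h1 : mulL hL.le hq (fnL hL p) =ᵐ[volume.restrict (Icc 0 L)]
      fun x => (q x : ℂ) * IccExtend hL.le (fnL hL p) x :=
    mulLinear_ae_eq hL.le hq (fnL hL p)
  filter_upwards [h1, ae_restrict_mem measurableSet_Icc] with x hx hmem
  rw [hx, IccExtend_of_mem _ _ hmem, fnL_apply]

end IntervalData

end

/-! ### Schrödinger operators on a finite family of intervals -/

noncomputable section

open Set

open scoped BoundedContinuousFunction ComplexConjugate InnerProductSpace

/-- A finite family of intervals carrying square integrable potentials. -/
structure MetricEdges (E : Type*) where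
  length : E → ℝ
  length_pos : ∀ e, 0 < length e
  potential : E → ℝ → ℝ
  potential_memLp : ∀ e, MemLp (potential e) 2 (volume.restrict (Icc 0 (length e)))

theorem isCompactOperator_pi {M ι : Type*} [TopologicalSpace M] [Zero M] [Finite ι] {N : ι → Type*}
    [∀ i, TopologicalSpace (N i)] {f : ∀ i, M → N i} (hf : ∀ i, IsCompactOperator (f i)) :
    IsCompactOperator fun x i => f i x := by
  choose K hK hKf using hf
  refine ⟨Set.pi univ K, isCompact_univ_pi hK, ?_⟩
  filter_upwards [Filter.eventually_all.2 hKf] with x hx i _ using hx i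

namespace MetricEdges

variable {E : Type*} (X : MetricEdges E)

/-- The direct sum of the `L²` spaces of the intervals. -/
abbrev L2 : Type _ := PiLp 2 (fun e : E => Lp ℂ 2 (volume.restrict (Icc 0 (X.length e))))

/-- Second derivatives and initial values of the functions in `H²` of the intervals; the values
are indexed by `(e, false)` and the derivatives by `(e, true)`. -/
abbrev Data : Type _ := X.L2 × (E × Bool → ℂ)

/-- The restriction to one interval. -/
def edge (e : E) : X.Data →L[ℂ] IntervalData (X.length e) :=
  ((PiLp.proj 2 (𝕜 := ℂ) (fun e : E => Lp ℂ 2 (volume.restrict (Icc 0 (X.length e)))) e).comp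
      (ContinuousLinearMap.fst ℂ _ _)).prod
    (((ContinuousLinearMap.proj (R := ℂ) (φ := fun _ : E × Bool => ℂ) (e, false)).comp
        (ContinuousLinearMap.snd ℂ _ _)).prod
      ((ContinuousLinearMap.proj (R := ℂ) (φ := fun _ : E × Bool => ℂ) (e, true)).comp
        (ContinuousLinearMap.snd ℂ _ _)))

theorem isSobolevH2 (p : X.Data) (e : E) :
    IsSobolevH2 (X.length e) (X.edge e p).fn (X.edge e p).deriv (p.1 e) :=
  (X.edge e p).isSobolevH2

/-- The operator of multiplication by a square integrable function. -/
def mulOp {q : E → ℝ → ℝ} (hq : ∀ e, MemLp (q e) 2 (volume.restrict (Icc 0 (X.length e)))) :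
    X.Data →L[ℂ] X.L2 :=
  ((PiLp.continuousLinearEquiv 2 ℂ
      (fun e : E => Lp ℂ 2 (volume.restrict (Icc 0 (X.length e))))).symm :
      (∀ e : E, Lp ℂ 2 (volume.restrict (Icc 0 (X.length e)))) →L[ℂ] X.L2).comp
    (ContinuousLinearMap.pi fun e => (IntervalData.mulL (X.length_pos e).le (hq e)).comp
      ((IntervalData.fnL (X.length_pos e)).comp (X.edge e)))

theorem mulOp_ae_eq {q : E → ℝ → ℝ}
    (hq : ∀ e, MemLp (q e) 2 (volume.restrict (Icc 0 (X.length e)))) (p : X.Data) (e : E) :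
    X.mulOp hq p e =ᵐ[volume.restrict (Icc 0 (X.length e))]
      fun x => (q e x : ℂ) * (X.edge e p).fn x :=
  IntervalData.mulL_fnL_ae_eq (X.length_pos e) (hq e) (X.edge e p)

/-- On each edge the operator factors through the compact map `fnL`. This covers both the potential
and, with `q = 1`, the inclusion of `H²` into `L²`. -/
theorem isCompactOperator_mulOp [Finite E] {q : E → ℝ → ℝ}
    (hq : ∀ e, MemLp (q e) 2 (volume.restrict (Icc 0 (X.length e)))) :
    IsCompactOperator (X.mulOp hq) := by
  refine IsCompactOperator.continuous_comp (f := ContinuousLinearMap.pi fun e =>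
    (IntervalData.mulL (X.length_pos e).le (hq e)).comp
      ((IntervalData.fnL (X.length_pos e)).comp (X.edge e))) ?_
    (PiLp.continuousLinearEquiv 2 ℂ _).symm.continuous
  refine isCompactOperator_pi (f := fun e => ⇑((IntervalData.mulL (X.length_pos e).le (hq e)).comp
    ((IntervalData.fnL (X.length_pos e)).comp (X.edge e)))) fun e => ?_
  exact ((IntervalData.isCompactOperator_fnL (X.length_pos e)).comp_clm (X.edge e)).clm_comp
    (IntervalData.mulL (X.length_pos e).le (hq e))

theorem memLp_one (e : E) :
    MemLp (fun _ : ℝ => (1 : ℝ)) 2 (volume.restrict (Icc 0 (X.length e))) :=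
  memLp_const 1

/-- The class in `L²` of the function with data `p`. -/
def toL2 : X.Data →L[ℂ] X.L2 := X.mulOp X.memLp_one

theorem toL2_ae_eq (p : X.Data) (e : E) :
    X.toL2 p e =ᵐ[volume.restrict (Icc 0 (X.length e))] (X.edge e p).fn := by
  filter_upwards [X.mulOp_ae_eq X.memLp_one p e] with x hx
  rw [toL2, hx, Complex.ofReal_one, one_mul]

theorem isCompactOperator_toL2 [Finite E] : IsCompactOperator X.toL2 := X.isCompactOperator_mulOp _

/-- The values at the ends of the intervals. -/
def val : X.Data →L[ℂ] (E × Bool → ℂ) :=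
  ContinuousLinearMap.pi fun b => (BoundedContinuousFunction.evalCLM ℂ
    (if b.2 then ⟨X.length b.1, (X.length_pos b.1).le, le_rfl⟩
      else ⟨0, le_rfl, (X.length_pos b.1).le⟩ : Icc 0 (X.length b.1))).comp
    ((IntervalData.fnL (X.length_pos b.1)).comp (X.edge b.1))

theorem val_true (p : X.Data) (e : E) : X.val p (e, true) = (X.edge e p).fn (X.length e) := rfl

theorem val_false (p : X.Data) (e : E) : X.val p (e, false) = (X.edge e p).fn 0 := rfl

/-- The inward derivatives at the ends of the intervals. -/
def der : X.Data →L[ℂ] (E × Bool → ℂ) :=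
  ContinuousLinearMap.pi fun b => if b.2
    then -(IntervalData.derivL (X.length b.1) (X.length b.1)).comp (X.edge b.1)
    else (IntervalData.derivL (X.length b.1) 0).comp (X.edge b.1)

theorem der_true (p : X.Data) (e : E) : X.der p (e, true) = -(X.edge e p).deriv (X.length e) := by
  rw [← IntervalData.derivL_apply _ ⟨(X.length_pos e).le, le_rfl⟩]
  rfl

theorem der_false (p : X.Data) (e : E) : X.der p (e, false) = (X.edge e p).deriv 0 := by
  rw [← IntervalData.derivL_apply _ ⟨le_rfl, (X.length_pos e).le⟩]
  rfl

/-- Values and inward derivatives at the ends of the intervals. -/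
def trace : X.Data →L[ℂ] (E × Bool → ℂ) × (E × Bool → ℂ) := X.val.prod X.der

theorem toL2_injective (p : X.Data) (h : X.toL2 p = 0) : p = 0 := by
  have key : ∀ e, (X.edge e p).1 = 0 ∧ (X.edge e p).2.1 = 0 ∧ (X.edge e p).2.2 = 0 := by
    intro e
    have hpos := X.length_pos e
    have hs := X.isSobolevH2 p e
    have h1 : (X.edge e p).fn =ᵐ[volume.restrict (Icc 0 (X.length e))] fun _ => (0 : ℂ) := by
      have h2 : X.toL2 p e = 0 := by rw [h]; rfl
      filter_upwards [X.toL2_ae_eq p e, Lp.coeFn_zero ℂ 2 (volume.restrict (Icc 0 (X.length e)))]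
        with x hx hx0
      rw [← hx, h2, hx0]
      rfl
    have h3 := Measure.eqOn_Icc_of_ae_eq volume hpos.ne h1 hs.continuousOn continuousOn_const
    obtain ⟨h4, h5⟩ := hs.eq_zero_of_eqOn_zero hpos fun x hx => h3 hx
    have hmem : (0 : ℝ) ∈ Icc 0 (X.length e) := ⟨le_rfl, hpos.le⟩
    refine ⟨(Lp.eq_zero_iff_ae_eq_zero).2 h5, ?_, ?_⟩
    · have := h3 hmem
      simpa [IntervalData.fn] using this
    · have := h4 0 hmem
      simpa [IntervalData.deriv] using this
  refine Prod.ext (PiLp.ext fun e => (key e).1) (funext ?_)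
  rintro ⟨e, _ | _⟩
  exacts [(key e).2.1, (key e).2.2]

/-! #### The maximal operator and its sesquilinear form -/

variable [Fintype E]

/-- Multiplication by the shifted potential. -/
def potOp (c : ℝ) : X.Data →L[ℂ] X.L2 := X.mulOp X.potential_memLp + (c : ℂ) • X.toL2

theorem isCompactOperator_potOp (c : ℝ) : IsCompactOperator (X.potOp c) :=
  (X.isCompactOperator_mulOp X.potential_memLp).add (X.isCompactOperator_toL2.smul (c : ℂ))

/-- The maximal operator `u ↦ -u'' + (V + c) u`. -/
def maxOp (c : ℝ) : X.Data →L[ℂ] X.L2 := X.potOp c - ContinuousLinearMap.fst ℂ _ _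

theorem maxOp_ae_eq (c : ℝ) (p : X.Data) (e : E) :
    X.maxOp c p e =ᵐ[volume.restrict (Icc 0 (X.length e))]
      fun x => -p.1 e x + (X.potential e x : ℂ) * (X.edge e p).fn x + c * (X.edge e p).fn x := by
  have h0 : X.maxOp c p e = X.mulOp X.potential_memLp p e + (c : ℂ) • X.toL2 p e - p.1 e := rfl
  rw [h0]
  filter_upwards [X.toL2_ae_eq p e, X.mulOp_ae_eq X.potential_memLp p e,
    Lp.coeFn_sub (X.mulOp X.potential_memLp p e + (c : ℂ) • X.toL2 p e) (p.1 e),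
    Lp.coeFn_add (X.mulOp X.potential_memLp p e) ((c : ℂ) • X.toL2 p e),
    Lp.coeFn_smul (c : ℂ) (X.toL2 p e)] with x h1 h2 h3 h4 h5
  rw [h3, Pi.sub_apply, h4, Pi.add_apply, h5, Pi.smul_apply, h1, h2, smul_eq_mul]
  ring

theorem maxOp_add (c : ℝ) (p : X.Data) : X.maxOp c p = X.maxOp 0 p + (c : ℂ) • X.toL2 p := by
  simp [maxOp, potOp]
  abel

/-- The sesquilinear form of the maximal operator, without boundary terms. -/
def form (c : ℝ) (p r : X.Data) : ℂ :=
  ⟪X.toL2 r, X.maxOp c p⟫_ℂ - ∑ b, X.der p b * conj (X.val r b)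

theorem inner_maxOp (c : ℝ) (p r : X.Data) :
    ⟪X.toL2 r, X.maxOp c p⟫_ℂ = X.form c p r + ∑ b, X.der p b * conj (X.val r b) := by
  rw [form]
  ring

theorem inner_toL2 (r : X.Data) (g : X.L2) : ⟪X.toL2 r, g⟫_ℂ =
    ∑ e, ∫ t in (0 : ℝ)..X.length e, g e t * conj ((X.edge e r).fn t) := by
  rw [PiLp.inner_apply]
  refine Finset.sum_congr rfl fun e _ => ?_
  rw [L2.inner_def, intervalIntegral.integral_of_le (X.length_pos e).le,
    ← integral_Icc_eq_integral_Ioc]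
  refine integral_congr_ae ?_
  filter_upwards [X.toL2_ae_eq r e] with x hx
  rw [hx]
  exact RCLike.inner_apply _ _

/-- Green's formula on each edge cancels the boundary sum in `form` and removes the second
derivative, which makes the Hermitian symmetry visible. -/
theorem form_eq (c : ℝ) (p r : X.Data) : X.form c p r =
    ∑ e, ((∫ t in (0 : ℝ)..X.length e, (X.edge e p).deriv t * conj ((X.edge e r).deriv t)) +
      (∫ t in (0 : ℝ)..X.length e,
        (X.potential e t : ℂ) * ((X.edge e p).fn t * conj ((X.edge e r).fn t))) +
      c * ∫ t in (0 : ℝ)..X.length e, (X.edge e p).fn t * conj ((X.edge e r).fn t)) := by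
  have hb : ∑ b, X.der p b * conj (X.val r b) =
      ∑ e, ((X.edge e p).deriv 0 * conj ((X.edge e r).fn 0) +
        -(X.edge e p).deriv (X.length e) * conj ((X.edge e r).fn (X.length e))) := by
    rw [Fintype.sum_prod_type]
    refine Finset.sum_congr rfl fun e _ => ?_
    rw [Fintype.sum_bool, val_true, val_false, der_true, der_false, add_comm]
  rw [form, inner_toL2, hb, ← Finset.sum_sub_distrib]
  refine Finset.sum_congr rfl fun e _ => ?_
  have hpos := X.length_pos e
  have hL := hpos.le
  have hp := X.isSobolevH2 p e
  have hr := X.isSobolevH2 r e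
  have hmem : X.length e ∈ Icc 0 (X.length e) := ⟨hL, le_rfl⟩
  have cp : ContinuousOn (X.edge e p).fn (uIcc 0 (X.length e)) := by
    rw [uIcc_of_le hL]
    exact hp.continuousOn
  have cr : ContinuousOn (fun t => conj ((X.edge e r).fn t)) (uIcc 0 (X.length e)) := by
    rw [uIcc_of_le hL]
    exact Complex.continuous_conj.comp_continuousOn hr.continuousOn
  have i1 : IntervalIntegrable (fun t => -p.1 e t * conj ((X.edge e r).fn t)) volume 0
      (X.length e) := (hp.intervalIntegrable_snd hmem).neg.mul_continuousOn cr
  have iq : IntervalIntegrable (fun t => (X.potential e t : ℂ)) volume 0 (X.length e) := by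
    rw [intervalIntegrable_iff_integrableOn_Icc_of_le hL]
    exact ((X.potential_memLp e).integrable (by norm_num)).ofReal
  have i2 : IntervalIntegrable (fun t => (X.potential e t : ℂ) *
      ((X.edge e p).fn t * conj ((X.edge e r).fn t))) volume 0 (X.length e) :=
    iq.mul_continuousOn (cp.mul cr)
  have i3 : IntervalIntegrable (fun t => (c : ℂ) *
      ((X.edge e p).fn t * conj ((X.edge e r).fn t))) volume 0 (X.length e) :=
    ((cp.mul cr).intervalIntegrable).const_mul _
  have hI : ∫ t in (0 : ℝ)..X.length e, X.maxOp c p e t * conj ((X.edge e r).fn t) =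
      ∫ t in (0 : ℝ)..X.length e, ((-p.1 e t * conj ((X.edge e r).fn t) +
        (X.potential e t : ℂ) * ((X.edge e p).fn t * conj ((X.edge e r).fn t))) +
        (c : ℂ) * ((X.edge e p).fn t * conj ((X.edge e r).fn t))) := by
    rw [intervalIntegral.integral_of_le hL, intervalIntegral.integral_of_le hL,
      ← integral_Icc_eq_integral_Ioc, ← integral_Icc_eq_integral_Ioc]
    refine integral_congr_ae ?_
    filter_upwards [X.maxOp_ae_eq c p e] with x hx
    rw [hx]
    ring
  rw [hI, intervalIntegral.integral_add (i1.add i2) i3, intervalIntegral.integral_add i1 i2,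
    hp.green hL hr, intervalIntegral.integral_const_mul]
  ring

theorem form_conj (c : ℝ) (p r : X.Data) : conj (X.form c p r) = X.form c r p := by
  rw [form_eq, form_eq, map_sum]
  refine Finset.sum_congr rfl fun e _ => ?_
  have hL := (X.length_pos e).le
  have hconj : ∀ f : ℝ → ℂ, conj (∫ t in (0 : ℝ)..X.length e, f t) =
      ∫ t in (0 : ℝ)..X.length e, conj (f t) := fun f => by
    rw [intervalIntegral.integral_of_le hL, intervalIntegral.integral_of_le hL, integral_conj]
  simp only [map_add, map_mul, hconj, Complex.conj_conj, Complex.conj_ofReal]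
  congr 1
  · congr 1
    · exact intervalIntegral.integral_congr fun t _ => mul_comm _ _
    · exact intervalIntegral.integral_congr fun t _ => by ring
  · congr 1
    exact intervalIntegral.integral_congr fun t _ => mul_comm _ _

theorem norm_toL2_sq (p : X.Data) :
    ‖X.toL2 p‖ ^ 2 = ∑ e, ∫ t in (0 : ℝ)..X.length e, ‖(X.edge e p).fn t‖ ^ 2 := by
  have h1 : ((‖X.toL2 p‖ ^ 2 : ℝ) : ℂ) = ⟪X.toL2 p, X.toL2 p⟫_ℂ := by
    rw [inner_self_eq_norm_sq_to_K]
    norm_cast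
  apply Complex.ofReal_injective
  rw [h1, inner_toL2, Complex.ofReal_sum]
  refine Finset.sum_congr rfl fun e _ => ?_
  rw [← intervalIntegral.integral_ofReal, intervalIntegral.integral_of_le (X.length_pos e).le,
    intervalIntegral.integral_of_le (X.length_pos e).le, ← integral_Icc_eq_integral_Ioc,
    ← integral_Icc_eq_integral_Ioc]
  refine integral_congr_ae ?_
  filter_upwards [X.toL2_ae_eq p e] with x hx
  rw [hx, Complex.mul_conj']
  norm_cast

theorem form_self_re (c : ℝ) (p : X.Data) : (X.form c p p).re =
    ∑ e, ((∫ t in (0 : ℝ)..X.length e, ‖(X.edge e p).deriv t‖ ^ 2) +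
      (∫ t in (0 : ℝ)..X.length e, X.potential e t * ‖(X.edge e p).fn t‖ ^ 2) +
      c * ∫ t in (0 : ℝ)..X.length e, ‖(X.edge e p).fn t‖ ^ 2) := by
  rw [form_eq]
  have h : ∀ e, ((∫ t in (0 : ℝ)..X.length e,
        (X.edge e p).deriv t * conj ((X.edge e p).deriv t)) +
      (∫ t in (0 : ℝ)..X.length e,
        (X.potential e t : ℂ) * ((X.edge e p).fn t * conj ((X.edge e p).fn t))) +
      c * ∫ t in (0 : ℝ)..X.length e, (X.edge e p).fn t * conj ((X.edge e p).fn t)) =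
      (((∫ t in (0 : ℝ)..X.length e, ‖(X.edge e p).deriv t‖ ^ 2) +
      (∫ t in (0 : ℝ)..X.length e, X.potential e t * ‖(X.edge e p).fn t‖ ^ 2) +
      c * ∫ t in (0 : ℝ)..X.length e, ‖(X.edge e p).fn t‖ ^ 2 : ℝ) : ℂ) := by
    intro e
    simp only [Complex.mul_conj', Complex.ofReal_add, Complex.ofReal_mul,
      ← intervalIntegral.integral_ofReal, Complex.ofReal_pow]
  rw [Finset.sum_congr rfl fun e _ => h e, ← Complex.ofReal_sum, Complex.ofReal_re]

/-- After a shift, the form dominates any multiple of the boundary values. -/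
theorem exists_form_bound {C : ℝ} (hC : 0 ≤ C) : ∃ c₀, ∀ c ≥ c₀, ∀ p : X.Data,
    C * (∑ b, ‖X.val p b‖ ^ 2) + ‖X.toL2 p‖ ^ 2 ≤ (X.form c p p).re := by
  choose k hk using fun e =>
    IsSobolevH2.exists_form_bound (X.length_pos e) (X.potential_memLp e) hC
  -- The sum dominates the constant of every edge; the extra `1` pays for `‖X.toL2 p‖ ^ 2`.
  refine ⟨(∑ e, |k e|) + 1, fun c hc p => ?_⟩
  rw [form_self_re, norm_toL2_sq, Fintype.sum_prod_type, Finset.mul_sum, ← Finset.sum_add_distrib]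
  refine Finset.sum_le_sum fun e _ => ?_
  have h1 := hk e _ _ _ (X.isSobolevH2 p e)
  rw [Fintype.sum_bool, val_true, val_false, add_comm (‖_‖ ^ 2)]
  have h2 : k e + 1 ≤ c := by
    have := Finset.single_le_sum (f := fun e => |k e|) (fun i _ => abs_nonneg _)
      (Finset.mem_univ e)
    have := le_abs_self (k e)
    linarith
  have h3 : 0 ≤ ∫ t in (0 : ℝ)..X.length e, ‖(X.edge e p).fn t‖ ^ 2 :=
    intervalIntegral.integral_nonneg (X.length_pos e).le fun t _ => sq_nonneg _
  have h4 := mul_le_mul_of_nonneg_right h2 h3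
  linarith

end MetricEdges

end

/-! ### Boundary conditions and resolvents -/

noncomputable section

open Set

open scoped ComplexConjugate InnerProductSpace

/-- A boundary condition is isotropic if the boundary terms in Green's formula vanish on it. -/
def VertexCondition.IsIsotropic {ι : Type*} [Fintype ι] (M : VertexCondition ι) : Prop :=
  ∀ x ∈ M, ∀ y ∈ M, ∑ b, x.2 b * conj (y.1 b) = ∑ b, x.1 b * conj (y.2 b)

/-- On an isotropic subspace, the boundary form is bounded by the boundary values alone. -/
theorem VertexCondition.IsIsotropic.exists_bound {ι : Type*} [Fintype ι] {M : VertexCondition ι}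
    (hM : M.IsIsotropic) :
    ∃ C, 0 ≤ C ∧ ∀ x ∈ M, ‖∑ b, x.2 b * conj (x.1 b)‖ ≤ C * ∑ b, ‖x.1 b‖ ^ 2 := by
  let π : M →ₗ[ℂ] (ι → ℂ) := (LinearMap.fst ℂ _ _).comp M.subtype
  obtain ⟨s, hs⟩ := π.rangeRestrict.exists_rightInverse_of_surjective π.range_rangeRestrict
  obtain ⟨s', hs'⟩ := s.exists_extend
  have hsec : ∀ x : M, ((s' (π x) : M) : (ι → ℂ) × (ι → ℂ)).1 = (x : (ι → ℂ) × (ι → ℂ)).1 := by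
    intro x
    have h1 : s' (π x) = s (π.rangeRestrict x) := by
      rw [← hs']
      rfl
    have h2 : π.rangeRestrict (s (π.rangeRestrict x)) = π.rangeRestrict x :=
      LinearMap.congr_fun hs (π.rangeRestrict x)
    rw [h1]
    exact congrArg Subtype.val h2
  -- A linear choice: `(F, τ F) ∈ M` for every `F` that occurs as a first component in `M`.
  let τ : (ι → ℂ) →L[ℂ] (ι → ℂ) :=
    LinearMap.toContinuousLinearMap ((LinearMap.snd ℂ _ _).comp (M.subtype.comp s'))
  refine ⟨Fintype.card ι * ‖τ‖, by positivity, fun x hx => ?_⟩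
  -- The difference `(0, x.2 - τ x.1)` belongs to `M`; by isotropy against `x`, replacing `x.2` by
  -- `τ x.1` does not change the boundary form.
  have hτ : ∑ b, x.2 b * conj (x.1 b) = ∑ b, τ x.1 b * conj (x.1 b) := by
    let y : M := ⟨x, hx⟩ - s' (π ⟨x, hx⟩)
    have hy1 : (y : (ι → ℂ) × (ι → ℂ)).1 = 0 := by
      change x.1 - ((s' (π ⟨x, hx⟩) : M) : (ι → ℂ) × (ι → ℂ)).1 = 0
      rw [hsec ⟨x, hx⟩, sub_self]
    have hy2 : (y : (ι → ℂ) × (ι → ℂ)).2 = x.2 - τ x.1 := rfl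
    have h := hM y y.2 x hx
    rw [hy1, hy2] at h
    simp only [Pi.sub_apply, sub_mul, Finset.sum_sub_distrib, Pi.zero_apply, zero_mul,
      Finset.sum_const_zero] at h
    exact sub_eq_zero.1 h
  rw [hτ]
  have hN : ‖x.1‖ ^ 2 ≤ ∑ b, ‖x.1 b‖ ^ 2 := by
    rcases isEmpty_or_nonempty ι with h | h
    · simp [Subsingleton.elim x.1 0]
    · obtain ⟨b, hb⟩ := Finite.exists_max fun b => ‖x.1 b‖
      have h1 : ‖x.1‖ ≤ ‖x.1 b‖ := (pi_norm_le_iff_of_nonneg (norm_nonneg _)).2 hb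
      calc ‖x.1‖ ^ 2 ≤ ‖x.1 b‖ ^ 2 := by gcongr
        _ ≤ _ := Finset.single_le_sum (f := fun b => ‖x.1 b‖ ^ 2) (fun i _ => sq_nonneg _)
          (Finset.mem_univ b)
  calc ‖∑ b, τ x.1 b * conj (x.1 b)‖ ≤ ∑ _b : ι, ‖τ‖ * ‖x.1‖ ^ 2 := by
        refine norm_sum_le_of_le _ fun b _ => ?_
        rw [norm_mul, RCLike.norm_conj, sq, ← mul_assoc]
        exact mul_le_mul ((norm_le_pi_norm _ b).trans (τ.le_opNorm _)) (norm_le_pi_norm _ b)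
          (norm_nonneg _) (by positivity)
    _ = Fintype.card ι * ‖τ‖ * ‖x.1‖ ^ 2 := by simp [mul_assoc]
    _ ≤ _ := mul_le_mul_of_nonneg_left hN (by positivity)

/-- An isotropic subspace given by as many equations as there are edge ends. -/
def VertexCondition.IsLagrangian {ι : Type*} [Fintype ι] (M : VertexCondition ι) : Prop :=
  M.IsIsotropic ∧ ∃ T : (ι → ℂ) × (ι → ℂ) →ₗ[ℂ] (ι → ℂ), M = LinearMap.ker T

namespace MetricEdges

variable {E : Type*} [Fintype E] (X : MetricEdges E)

theorem form_sub_sub (c : ℝ) (p r : X.Data) : X.form c (p - r) (p - r) =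
    X.form c p p - X.form c p r - X.form c r p + X.form c r r := by
  simp only [form, map_sub, inner_sub_left, inner_sub_right, Pi.sub_apply, sub_mul, mul_sub,
    Finset.sum_sub_distrib]
  ring

/-- The shift `c` makes the form with the boundary condition `M` positive. -/
def IsPositiveShift (M : VertexCondition (E × Bool)) (c : ℝ) : Prop :=
  ∀ (p : X.Data) (F' : E × Bool → ℂ), (X.val p, F') ∈ M →
    ‖X.toL2 p‖ ^ 2 ≤ (X.form c p p + ∑ b, F' b * conj (X.val p b)).re

/-- Isotropy bounds the boundary term by the boundary values alone, and the trace inequality absorbs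
these after a shift. In `IsPositiveShift` the vector `F'` need not be the derivative of `p`: only
the part of the condition that restricts values is imposed, as in the form domain. -/
theorem exists_isPositiveShift {M : VertexCondition (E × Bool)} (hM : M.IsIsotropic) :
    ∃ c₀, ∀ c ≥ c₀, X.IsPositiveShift M c := by
  obtain ⟨C, hC0, hC⟩ := hM.exists_bound
  obtain ⟨c₀, hc₀⟩ := X.exists_form_bound hC0
  refine ⟨c₀, fun c hc p F' hF => ?_⟩
  have h1 := hC _ hF
  have h2 := hc₀ c hc p
  have h3 := (abs_le.1 (Complex.abs_re_le_norm (∑ b, F' b * conj (X.val p b)))).1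
  simp only at h1
  rw [Complex.add_re]
  linarith

/-- `S` solves the boundary value problem `-u'' + (V + c) u = g` with boundary condition `M`. -/
structure IsSolutionOperator (M : VertexCondition (E × Bool)) (c : ℝ) (S : X.L2 →L[ℂ] X.Data) :
    Prop where
  trace_mem : ∀ g, X.trace (S g) ∈ M
  maxOp_apply : ∀ g, X.maxOp c (S g) = g
  apply_maxOp : ∀ p, X.trace p ∈ M → S (X.maxOp c p) = p

theorem eq_zero_of_maxOp_eq_zero {M : VertexCondition (E × Bool)} {c : ℝ}
    (hc : X.IsPositiveShift M c) {p : X.Data} (hp : X.trace p ∈ M) (h : X.maxOp c p = 0) :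
    p = 0 := by
  have h1 := hc p (X.der p) hp
  rw [← inner_maxOp, h, inner_zero_right, Complex.zero_re] at h1
  refine X.toL2_injective p (norm_eq_zero.1 ?_)
  nlinarith [norm_nonneg (X.toL2 p)]

/-- Existence from uniqueness by the Fredholm alternative. The target of `T` has the same dimension
as the space of initial values, so the equation and the boundary condition together define an
endomorphism of `Data` of the form identity minus compact. -/
theorem exists_isSolutionOperator {M : VertexCondition (E × Bool)} (hM : M.IsLagrangian) {c : ℝ}
    (hc : X.IsPositiveShift M c) : ∃ S, X.IsSolutionOperator M c S := by
  obtain ⟨-, T, rfl⟩ := hM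
  let B : X.Data →L[ℂ] (E × Bool → ℂ) := (LinearMap.toContinuousLinearMap T).comp X.trace
  -- Chosen so that `p - K p = (-X.maxOp c p, B p)`; the second component of `K` is compact because
  -- it has finite rank.
  let K : X.Data →L[ℂ] X.Data := (X.potOp c).prod (ContinuousLinearMap.snd ℂ _ _ - B)
  have hK : IsCompactOperator K := by
    have h1 := X.isCompactOperator_potOp c
    have h2 : IsCompactOperator (ContinuousLinearMap.snd ℂ X.L2 (E × Bool → ℂ) - B) :=
      isCompactOperator_of_locallyCompactSpace_dom _
    obtain ⟨K₁, hK₁, h1⟩ := h1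
    obtain ⟨K₂, hK₂, h2⟩ := h2
    refine ⟨K₁ ×ˢ K₂, hK₁.prod hK₂, ?_⟩
    filter_upwards [h1, h2] with x hx1 hx2 using ⟨hx1, hx2⟩
  have hsub : ∀ p, p - K p = (-X.maxOp c p, B p) := fun p => by
    refine Prod.ext ?_ ?_
    · change p.1 - X.potOp c p = -(X.potOp c p - p.1)
      abel
    · change p.2 - (p.2 - B p) = B p
      abel
  have hne : ¬ Module.End.HasEigenvalue (K : X.Data →ₗ[ℂ] X.Data) 1 := by
    intro h
    obtain ⟨p, hp, hp0⟩ := h.exists_hasEigenvector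
    rw [Module.End.mem_eigenspace_iff, one_smul, ContinuousLinearMap.coe_coe] at hp
    have h1 := hsub p
    rw [hp, sub_self] at h1
    have h2 : X.maxOp c p = 0 := neg_eq_zero.1 (congrArg Prod.fst h1).symm
    have h3 : B p = 0 := (congrArg Prod.snd h1).symm
    exact hp0 (X.eq_zero_of_maxOp_eq_zero hc (LinearMap.mem_ker.2 h3) h2)
  have hunit : IsUnit (1 - K) := by
    have := (hK.hasEigenvalue_or_mem_resolventSet one_ne_zero).resolve_left hne
    rwa [spectrum.mem_resolventSet_iff, map_one] at this
  obtain ⟨⟨a, i, hai, hia⟩, ha⟩ := hunit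
  simp only at ha
  subst ha
  have h1 : ∀ p, i (p - K p) = p := fun p => by
    have := DFunLike.congr_fun hia p
    simpa using this
  have h2 : ∀ p, i p - K (i p) = p := fun p => by
    have := DFunLike.congr_fun hai p
    simpa using this
  have h3 : ∀ g, (-X.maxOp c (i (-g, 0)), B (i (-g, 0))) = (-g, 0) := fun g => by
    rw [← hsub, h2]
  refine ⟨i.comp ((-ContinuousLinearMap.id ℂ X.L2).prod 0), fun g => ?_, fun g => ?_,
    fun p hp => ?_⟩
  · exact LinearMap.mem_ker.2 (congrArg Prod.snd (h3 g))
  · exact neg_injective (congrArg Prod.fst (h3 g))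
  · have h4 : B p = 0 := hp
    have h5 := h1 p
    rw [hsub, h4] at h5
    exact h5

variable {X} {M M' : VertexCondition (E × Bool)} {c : ℝ} {S S' : X.L2 →L[ℂ] X.Data}

theorem IsSolutionOperator.isPositiveResolvent (hS : X.IsSolutionOperator M c S)
    (hM : M.IsIsotropic) (hc : X.IsPositiveShift M c) : IsPositiveResolvent (X.toL2.comp S) where
  compact := X.isCompactOperator_toL2.comp_clm S
  symm g h := by
    change ⟪X.toL2 (S g), h⟫_ℂ = ⟪g, X.toL2 (S h)⟫_ℂ
    have h1 := X.inner_maxOp c (S h) (S g)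
    have h2 := X.inner_maxOp c (S g) (S h)
    rw [hS.maxOp_apply] at h1 h2
    have h3 := hM _ (hS.trace_mem h) _ (hS.trace_mem g)
    change ∑ b, X.der (S h) b * conj (X.val (S g) b) =
      ∑ b, X.val (S h) b * conj (X.der (S g) b) at h3
    rw [← inner_conj_symm g, h2, map_add, form_conj, h1, h3, map_sum]
    congr 1
    refine Finset.sum_congr rfl fun b _ => ?_
    rw [map_mul, Complex.conj_conj, mul_comm]
  nonneg g := by
    change 0 ≤ (⟪X.toL2 (S g), g⟫_ℂ).re
    have h1 := hc (S g) (X.der (S g)) (hS.trace_mem g)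
    rw [← inner_maxOp, hS.maxOp_apply] at h1
    exact (sq_nonneg _).trans h1
  inj g h := by
    rw [← hS.maxOp_apply g, X.toL2_injective (S g) h, map_zero]

/-- Comparison of resolvents: the condition `M'` has the smaller form domain. -/
theorem IsSolutionOperator.re_inner_le (hS : X.IsSolutionOperator M c S)
    (hS' : X.IsSolutionOperator M' c S') (hM : M.IsIsotropic) (hc : X.IsPositiveShift M c)
    (hle : ∀ x ∈ M', ∃ F', (x.1, F') ∈ M ∧
      ∑ b, F' b * conj (x.1 b) = ∑ b, x.2 b * conj (x.1 b)) (g : X.L2) :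
    (⟪X.toL2 (S' g), g⟫_ℂ).re ≤ (⟪X.toL2 (S g), g⟫_ℂ).re := by
  set p := S g with hp
  set k := S' g with hk
  have hpM : (X.val p, X.der p) ∈ M := hS.trace_mem g
  obtain ⟨F', hF, hsum⟩ := hle (X.trace k) (hS'.trace_mem g)
  change (X.val k, F') ∈ M at hF
  change ∑ b, F' b * conj (X.val k b) = ∑ b, X.der k b * conj (X.val k b) at hsum
  -- `p - k` need not satisfy the condition `M`, since `k` only satisfies `M'`; with `F'` in place
  -- of the derivatives of `k` its boundary values still belong to `M`, which suffices for
  -- positivity.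
  have hd : (X.val (p - k), X.der p - F') ∈ M := by
    rw [map_sub]
    exact M.sub_mem hpM hF
  have hpos := (sq_nonneg _).trans (hc (p - k) _ hd)
  have e1 := X.inner_maxOp c p p
  have e2 := X.inner_maxOp c p k
  have e3 := X.inner_maxOp c k k
  rw [hp, hS.maxOp_apply, ← hp] at e1 e2
  rw [hk, hS'.maxOp_apply, ← hk, ← hsum] at e3
  have e4 : ∑ b, F' b * conj (X.val p b) = conj (∑ b, X.der p b * conj (X.val k b)) := by
    have := hM _ hF _ hpM
    simp only at this
    rw [this, map_sum]
    refine Finset.sum_congr rfl fun b _ => ?_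
    rw [map_mul, Complex.conj_conj, mul_comm]
  have e5 : X.form c k p = conj (X.form c p k) := (X.form_conj c p k).symm
  -- With `q` the form including its boundary term, `q(p, p) = ⟪p, g⟫`, `q(p, k) = q(k, k) = ⟪k, g⟫`
  -- and `q(k, p)` is the conjugate of `q(p, k)`. Hence `0 ≤ q(p - k, p - k)` has the difference of
  -- the two resolvent forms as its real part.
  have e6 : X.form c (p - k) (p - k) + ∑ b, (X.der p - F') b * conj (X.val (p - k) b) =
      ⟪X.toL2 p, g⟫_ℂ - ⟪X.toL2 k, g⟫_ℂ - conj ⟪X.toL2 k, g⟫_ℂ + ⟪X.toL2 k, g⟫_ℂ := by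
    have e7 : ∑ b, (X.der p - F') b * conj (X.val (p - k) b) =
        (∑ b, X.der p b * conj (X.val p b)) - (∑ b, X.der p b * conj (X.val k b)) -
        (∑ b, F' b * conj (X.val p b)) + ∑ b, F' b * conj (X.val k b) := by
      simp only [map_sub, Pi.sub_apply, sub_mul, mul_sub, Finset.sum_sub_distrib]
      ring
    rw [e7, form_sub_sub, e5, e4]
    nth_rewrite 3 [e3]
    rw [e1, e2, map_add]
    ring
  rw [e6] at hpos
  simp only [Complex.add_re, Complex.sub_re, Complex.conj_re] at hpos
  linarith

/-- The resolvents agree where the solution operator for `M` produces functions that satisfy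
the condition `M'`. -/
theorem IsSolutionOperator.eq_of_trace_mem (hS : X.IsSolutionOperator M c S)
    (hS' : X.IsSolutionOperator M' c S') {g : X.L2} (h : X.trace (S g) ∈ M') : S g = S' g := by
  have := hS'.apply_maxOp (S g) h
  rw [hS.maxOp_apply] at this
  exact this.symm

/-- If there is at least one interval, `L²` has infinite dimension. -/
theorem not_finiteDimensional_L2 [Nonempty E] (X : MetricEdges E) :
    ¬ FiniteDimensional ℂ X.L2 := by
  intro h
  -- `toL2` embeds `X.L2 × (E × Bool → ℂ)` into `X.L2`, which is impossible in finite dimension.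
  have h1 := LinearMap.finrank_le_finrank_of_injective (f := (X.toL2 : X.Data →ₗ[ℂ] X.L2))
    ((injective_iff_map_eq_zero _).2 X.toL2_injective)
  rw [Module.finrank_prod, Module.finrank_fintype_fun_eq_card] at h1
  have h2 : 0 < Fintype.card (E × Bool) := Fintype.card_pos
  omega

end MetricEdges

end

/-! ### Vertex conditions -/

noncomputable section

open Set

open scoped ComplexConjugate InnerProductSpace

namespace VertexCondition

variable {ι κ : Type*}

theorem mem_transport {i : ι → κ} {M : VertexCondition ι} {x : (κ → ℂ) × (κ → ℂ)} :
    x ∈ M.transport i ↔ ((fun b => x.1 (i b)), fun b => x.2 (i b)) ∈ M := Iff.rfl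

variable [Fintype ι] [Fintype κ]

theorem mem_delta {α : ℝ} {x : (ι → ℂ) × (ι → ℂ)} : x ∈ delta ι α ↔
    (∀ b c, x.1 b = x.1 c) ∧ ∀ b, ∑ c, x.2 c = (α : ℂ) * x.1 b := Iff.rfl

theorem isLagrangian_delta [Nonempty ι] (α : ℝ) : (delta ι α).IsLagrangian := by
  classical
  let o : ι := Classical.arbitrary ι
  constructor
  · rintro x ⟨hx, hx'⟩ y ⟨hy, hy'⟩
    have h1 : ∑ b, x.2 b * conj (y.1 b) = (α * x.1 o) * conj (y.1 o) := by
      rw [← hx' o, Finset.sum_mul]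
      exact Finset.sum_congr rfl fun b _ => by rw [hy b o]
    have h2 : ∑ b, x.1 b * conj (y.2 b) = x.1 o * conj (α * y.1 o) := by
      rw [← hy' o, map_sum, Finset.mul_sum]
      exact Finset.sum_congr rfl fun b _ => by rw [hx b o]
    rw [h1, h2, map_mul, Complex.conj_ofReal]
    ring
  -- The equation indexed by the reference end `o` is the derivative condition; the others compare
  -- the value at `b` with that at `o`.
  · refine ⟨LinearMap.pi fun b => if b = o
      then (∑ c, (LinearMap.proj c).comp (LinearMap.snd ℂ (ι → ℂ) (ι → ℂ))) -
        (α : ℂ) • (LinearMap.proj o).comp (LinearMap.fst ℂ (ι → ℂ) (ι → ℂ))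
      else (LinearMap.proj b).comp (LinearMap.fst ℂ (ι → ℂ) (ι → ℂ)) -
        (LinearMap.proj o).comp (LinearMap.fst ℂ (ι → ℂ) (ι → ℂ)), ?_⟩
    ext x
    rw [mem_delta, LinearMap.mem_ker, funext_iff]
    constructor
    · rintro ⟨h1, h2⟩ b
      by_cases hb : b = o
      · simp [hb, h2 o]
      · simp [hb, h1 b o]
    · intro h
      have h1 : ∀ b, x.1 b = x.1 o := fun b => by
        by_cases hb : b = o
        · rw [hb]
        · have := h b
          simpa [hb, sub_eq_zero] using this
      refine ⟨fun b c => (h1 b).trans (h1 c).symm, fun b => ?_⟩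
      have := h o
      rw [h1 b]
      simpa [sub_eq_zero] using this

theorem dotProduct_conjTranspose_mulVec (P Q : Matrix ι ι ℂ) (a b : ι → ℂ) :
    dotProduct (P.conjTranspose.mulVec a) (star (Q.conjTranspose.mulVec b)) =
      dotProduct (star b) ((Q * P.conjTranspose).mulVec a) := by
  rw [Matrix.star_mulVec, Matrix.conjTranspose_conjTranspose, dotProduct_comm,
    ← Matrix.dotProduct_mulVec, Matrix.mulVec_mulVec]

-- The kernel of `(A B)` is parametrised by `a ↦ (B* a, -A* a)`. The range lies in the kernel
-- because `A B* = B A*`, and both have dimension `d` because `(A B)` has rank `d`. On such pairs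
-- the boundary form is symmetric, again because `A B* = B A*`.
open scoped ComplexOrder in
theorem IsSelfAdjoint.isLagrangian {M : VertexCondition ι} (hM : M.IsSelfAdjoint) :
    M.IsLagrangian := by
  classical
  obtain ⟨A, B, hrank, hherm, hmem⟩ := hM
  let T : (ι → ℂ) × (ι → ℂ) →ₗ[ℂ] (ι → ℂ) := A.mulVecLin.coprod B.mulVecLin
  let G : (ι → ℂ) →ₗ[ℂ] (ι → ℂ) × (ι → ℂ) :=
    B.conjTranspose.mulVecLin.prod (-A.conjTranspose.mulVecLin)
  have hMT : M = LinearMap.ker T := by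
    ext ⟨F, F'⟩
    rw [hmem]
    rfl
  have hsymm : B * A.conjTranspose = A * B.conjTranspose := by
    have := hherm.eq
    rwa [Matrix.conjTranspose_mul, Matrix.conjTranspose_conjTranspose] at this
  have hsurj : LinearMap.range T = ⊤ := by
    have h1 : LinearMap.range (Matrix.fromCols A B).mulVecLin = ⊤ :=
      Submodule.eq_top_of_finrank_eq (by
        rw [Module.finrank_fintype_fun_eq_card]
        exact hrank)
    rw [LinearMap.range_eq_top] at h1 ⊢
    intro y
    obtain ⟨v, hv⟩ := h1 y
    refine ⟨(v ∘ Sum.inl, v ∘ Sum.inr), ?_⟩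
    rw [← hv]
    exact (Matrix.fromCols_mulVec A B v).symm
  have hinj : LinearMap.ker G = ⊥ := by
    have h1 : (Matrix.fromCols A B).conjTranspose.rank = Fintype.card ι := by
      rw [Matrix.rank_conjTranspose, hrank]
    have h2 := (Matrix.fromCols A B).conjTranspose.mulVecLin.finrank_range_add_finrank_ker
    rw [Module.finrank_fintype_fun_eq_card] at h2
    change (Matrix.fromCols A B).conjTranspose.rank + _ = _ at h2
    have h3 : LinearMap.ker (Matrix.fromCols A B).conjTranspose.mulVecLin = ⊥ :=
      Submodule.finrank_eq_zero.1 (by omega)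
    rw [LinearMap.ker_eq_bot'] at h3 ⊢
    intro x hx
    have hB : B.conjTranspose.mulVec x = 0 := congrArg Prod.fst hx
    have hA : A.conjTranspose.mulVec x = 0 := neg_eq_zero.1 (congrArg Prod.snd hx)
    refine h3 x ?_
    rw [Matrix.mulVecLin_apply, Matrix.conjTranspose_fromCols_eq_fromRows_conjTranspose,
      Matrix.fromRows_mulVec, hA, hB]
    ext (i | i) <;> rfl
  have hle : LinearMap.range G ≤ LinearMap.ker T := by
    rintro _ ⟨x, rfl⟩
    rw [LinearMap.mem_ker]
    change A.mulVec (B.conjTranspose.mulVec x) + B.mulVec (-A.conjTranspose.mulVec x) = 0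
    rw [Matrix.mulVec_neg, Matrix.mulVec_mulVec, Matrix.mulVec_mulVec, hsymm, add_neg_cancel]
  have hker : LinearMap.range G = LinearMap.ker T := by
    refine Submodule.eq_of_le_of_finrank_eq hle ?_
    have h1 := G.finrank_range_add_finrank_ker
    have h2 := T.finrank_range_add_finrank_ker
    rw [hinj, finrank_bot, Module.finrank_fintype_fun_eq_card] at h1
    rw [hsurj, finrank_top, Module.finrank_prod, Module.finrank_fintype_fun_eq_card] at h2
    omega
  refine ⟨fun x hx y hy => ?_, T, hMT⟩
  rw [hMT, ← hker] at hx hy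
  obtain ⟨a, rfl⟩ := hx
  obtain ⟨b, rfl⟩ := hy
  have h1 := dotProduct_conjTranspose_mulVec A B a b
  have h2 := dotProduct_conjTranspose_mulVec B A a b
  rw [hsymm, ← h2] at h1
  change ∑ i, (-A.conjTranspose.mulVec a) i * conj (B.conjTranspose.mulVec b i) =
    ∑ i, B.conjTranspose.mulVec a i * conj ((-A.conjTranspose.mulVec b) i)
  simp only [Pi.neg_apply, map_neg, neg_mul, mul_neg, Finset.sum_neg_distrib]
  exact congrArg Neg.neg h1

theorem IsLagrangian.transport {M : VertexCondition ι} (hM : M.IsLagrangian) {i : ι → κ}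
    (hi : Function.Bijective i) : (M.transport i).IsLagrangian := by
  obtain ⟨hiso, T, hT⟩ := hM
  constructor
  · intro x hx y hy
    have h := hiso _ (mem_transport.1 hx) _ (mem_transport.1 hy)
    rw [← hi.sum_comp, ← hi.sum_comp]
    exact h
  · let e := Equiv.ofBijective i hi
    refine ⟨(LinearMap.funLeft ℂ ℂ e.symm).comp (T.comp
      ((LinearMap.funLeft ℂ ℂ i).prodMap (LinearMap.funLeft ℂ ℂ i))), ?_⟩
    rw [LinearMap.ker_comp_of_ker_eq_bot, LinearMap.ker_comp, ← hT]
    · rfl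
    · exact LinearMap.ker_eq_bot.2
        (LinearMap.funLeft_injective_of_surjective ℂ ℂ _ e.symm.surjective)

end VertexCondition

/-! ### The Hamiltonian of a quantum graph as a boundary value problem. -/

namespace QuantumGraph

variable {V E : Type*}

/-- The intervals and potentials of a quantum graph. -/
abbrev toMetricEdges (Γ : QuantumGraph V E) : MetricEdges E where
  length := Γ.length
  length_pos := Γ.length_pos
  potential := Γ.potential
  potential_memLp := Γ.potential_memLp

/-- All vertex conditions of a quantum graph, as one condition on all edge ends. -/
def boundary (Γ : QuantumGraph V E) : VertexCondition (E × Bool) :=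
  ⨅ v, (Γ.cond v).transport Subtype.val

theorem mem_boundary {Γ : QuantumGraph V E} {x : (E × Bool → ℂ) × (E × Bool → ℂ)} :
    x ∈ Γ.boundary ↔
      ∀ v, ((fun b : Γ.EndsAt v => x.1 b), fun b : Γ.EndsAt v => x.2 b) ∈ Γ.cond v := by
  simp only [boundary, Submodule.mem_iInf]
  rfl

variable [Fintype E]

/-- The edge ends are partitioned by their vertices, so the boundary form is a sum over vertices,
and the equation indexed by `b` can be taken from the vertex of `b`. -/
theorem isLagrangian_boundary [Finite V] [DecidableEq V] {Γ : QuantumGraph V E}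
    (h : ∀ v, (Γ.cond v).IsLagrangian) : Γ.boundary.IsLagrangian := by
  constructor
  · intro x hx y hy
    rw [mem_boundary] at hx hy
    have := Fintype.ofFinite V
    rw [← Fintype.sum_fiberwise (g := Γ.vert), ← Fintype.sum_fiberwise (g := Γ.vert)]
    exact Finset.sum_congr rfl fun v _ => (h v).1 _ (hx v) _ (hy v)
  · choose T hT using fun v => (h v).2
    refine ⟨LinearMap.pi fun b => (LinearMap.proj (⟨b, rfl⟩ : Γ.EndsAt (Γ.vert b))).comp
      ((T (Γ.vert b)).comp ((LinearMap.funLeft ℂ ℂ Subtype.val).prodMap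
        (LinearMap.funLeft ℂ ℂ Subtype.val))), ?_⟩
    ext x
    rw [mem_boundary, LinearMap.mem_ker, funext_iff]
    constructor
    · intro hx b
      have h1 := hx (Γ.vert b)
      rw [hT, LinearMap.mem_ker] at h1
      exact congrFun h1 ⟨b, rfl⟩
    · intro hx v
      rw [hT, LinearMap.mem_ker]
      ext ⟨b, rfl⟩
      exact hx b

theorem mem_hamiltonian_iff (Γ : QuantumGraph V E) (f g : Γ.L2) :
    (f, g) ∈ Γ.hamiltonian ↔ ∃ p : Γ.toMetricEdges.Data, Γ.toMetricEdges.trace p ∈ Γ.boundary ∧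
      Γ.toMetricEdges.toL2 p = f ∧ Γ.toMetricEdges.maxOp 0 p = g := by
  set X := Γ.toMetricEdges
  constructor
  · rintro ⟨u, u', u'', hu, hf, hg, hv⟩
    let w : Γ.L2 := WithLp.toLp 2 fun e => (hu e).memLp.toLp (u'' e)
    -- In `Data` the Boolean selects the value or the derivative at `0`; it does not stand for the
    -- two ends of the edge.
    let p : X.Data := (w, fun b => if b.2 then u' b.1 0 else u b.1 0)
    have hw : ∀ e, p.1 e =ᵐ[volume.restrict (Icc 0 (X.length e))] u'' e :=
      fun e => (hu e).memLp.coeFn_toLp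
    have hderiv : ∀ e, ∀ x ∈ Icc 0 (X.length e), (X.edge e p).deriv x = u' e x := by
      intro e x hx
      rw [(hu e).deriv_eq x hx]
      change u' e 0 + _ = _
      congr 1
      rw [intervalIntegral.integral_of_le hx.1, intervalIntegral.integral_of_le hx.1]
      exact integral_congr_ae (ae_mono (Measure.restrict_mono
        (Ioc_subset_Icc_self.trans (Icc_subset_Icc_right hx.2)) le_rfl) (hw e))
    have hfn : ∀ e, ∀ x ∈ Icc 0 (X.length e), (X.edge e p).fn x = u e x := by
      intro e x hx
      rw [(hu e).eq x hx]
      change u e 0 + _ = _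
      congr 1
      refine intervalIntegral.integral_congr fun t ht => ?_
      rw [uIcc_of_le hx.1] at ht
      exact hderiv e t ⟨ht.1, ht.2.trans hx.2⟩
    have h0 : ∀ e, (0 : ℝ) ∈ Icc 0 (X.length e) := fun e => ⟨le_rfl, (X.length_pos e).le⟩
    have hl : ∀ e, X.length e ∈ Icc 0 (X.length e) := fun e => ⟨(X.length_pos e).le, le_rfl⟩
    have hval : ∀ b, X.val p b = Γ.endValue u b := by
      rintro ⟨e, _ | _⟩
      · exact (X.val_false p e).trans (hfn e 0 (h0 e))
      · exact (X.val_true p e).trans (hfn e _ (hl e))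
    have hder : ∀ b, X.der p b = Γ.endDeriv u' b := by
      rintro ⟨e, _ | _⟩
      · exact (X.der_false p e).trans (hderiv e 0 (h0 e))
      · exact (X.der_true p e).trans (congrArg Neg.neg (hderiv e _ (hl e)))
    refine ⟨p, mem_boundary.2 fun v => ?_, PiLp.ext fun e => Lp.ext ?_, PiLp.ext fun e => Lp.ext ?_⟩
    · convert hv v using 1
      exact Prod.ext (funext fun b => hval b) (funext fun b => hder b)
    · filter_upwards [X.toL2_ae_eq p e, hf e, ae_restrict_mem measurableSet_Icc] with x h1 h2 h3
      rw [h1, h2, hfn e x h3]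
    · filter_upwards [X.maxOp_ae_eq 0 p e, hg e, ae_restrict_mem measurableSet_Icc, hw e]
        with x h1 h2 h3 h4
      rw [h1, h2, hfn e x h3, h4, Complex.ofReal_zero, zero_mul, add_zero]
  · rintro ⟨p, hp, rfl, rfl⟩
    refine ⟨fun e => (X.edge e p).fn, fun e => (X.edge e p).deriv, fun e => p.1 e,
      fun e => X.isSobolevH2 p e, fun e => X.toL2_ae_eq p e, fun e => ?_, fun v => ?_⟩
    · filter_upwards [X.maxOp_ae_eq 0 p e] with x hx
      rw [hx, Complex.ofReal_zero, zero_mul, add_zero]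
    · have hval : ∀ b, X.val p b = Γ.endValue (fun e => (X.edge e p).fn) b := by
        rintro ⟨e, _ | _⟩ <;> rfl
      have hder : ∀ b, X.der p b = Γ.endDeriv (fun e => (X.edge e p).deriv) b := by
        rintro ⟨e, _ | _⟩
        · exact X.der_false p e
        · exact X.der_true p e
      convert mem_boundary.1 hp v using 1
      exact Prod.ext (funext fun b => (hval b).symm) (funext fun b => (hder b).symm)

/-- `H f = μ f` means `(H + c) f = (μ + c) f`, that is, `f = (μ + c) R f`; this form needs no
division and includes `μ = -c`. -/
theorem eigenspace_eq (Γ : QuantumGraph V E) {c : ℝ}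
    {S : Γ.toMetricEdges.L2 →L[ℂ] Γ.toMetricEdges.Data}
    (hS : Γ.toMetricEdges.IsSolutionOperator Γ.boundary c S) (μ : ℂ) :
    Γ.eigenspace μ = shiftedEigenspace (Γ.toMetricEdges.toL2.comp S) c μ := by
  ext f
  rw [mem_shiftedEigenspace]
  change (f, μ • f) ∈ Γ.hamiltonian ↔ f = (μ + c) • Γ.toMetricEdges.toL2 (S f)
  rw [mem_hamiltonian_iff]
  constructor
  · rintro ⟨p, hp, rfl, hμ⟩
    have h1 := hS.apply_maxOp p hp
    rw [MetricEdges.maxOp_add, hμ, ← add_smul, map_smul] at h1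
    rw [← map_smul, h1]
  · intro hf
    refine ⟨(μ + c) • S f, ?_, ?_, ?_⟩
    · rw [map_smul]
      exact Submodule.smul_mem _ _ (hS.trace_mem f)
    · rw [map_smul, ← hf]
    · have h1 := Γ.toMetricEdges.maxOp_add c ((μ + c) • S f)
      rw [map_smul, hS.maxOp_apply, map_smul (Γ.toMetricEdges.toL2), ← hf, add_smul] at h1
      exact (add_right_cancel h1).symm

theorem isEigenvalueSequence_iff (Γ : QuantumGraph V E) {c : ℝ}
    {S : Γ.toMetricEdges.L2 →L[ℂ] Γ.toMetricEdges.Data}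
    (hS : Γ.toMetricEdges.IsSolutionOperator Γ.boundary c S) (l : ℕ → ℝ) :
    Γ.IsEigenvalueSequence l ↔
      IsShiftedEigenvalueSequence (Γ.toMetricEdges.toL2.comp S) c l := by
  refine and_congr Iff.rfl (forall_congr' fun μ => ?_)
  rw [eigenspace_eq Γ hS μ]

end QuantumGraph

end

/-! ### Gluing two vertices -/

noncomputable section

open scoped ComplexConjugate InnerProductSpace

namespace QuantumGraph

variable {V E : Type*} [DecidableEq V]

theorem glueMap_eq_glued_iff {v₀ v₁ : V} (h : v₀ ≠ v₁) (v : V) :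
    glueMap v₀ v₁ h v = ⟨v₀, h⟩ ↔ v = v₀ ∨ v = v₁ := by
  by_cases hv : v = v₁
  · simp [glueMap, hv]
  · simp [glueMap, hv]

theorem eq_of_glueMap_eq {v₀ v₁ : V} (h : v₀ ≠ v₁) {v : V} {w : {v : V // v ≠ v₁}}
    (hw : w.1 ≠ v₀) (hv : glueMap v₀ v₁ h v = w) : v = w.1 := by
  by_cases hv₁ : v = v₁
  · exact absurd (by simp [← hv, glueMap, hv₁]) hw
  · simp [← hv, glueMap, hv₁]

variable [Fintype E] (Γ : QuantumGraph V E) {v₀ v₁ : V} (hne : v₀ ≠ v₁)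

theorem glue_cond_glued (α : ℝ) :
    (Γ.glue v₀ v₁ hne α).cond ⟨v₀, hne⟩ =
      VertexCondition.delta ((Γ.glue v₀ v₁ hne α).EndsAt ⟨v₀, hne⟩) α :=
  if_pos rfl

theorem glue_cond_of_ne (α : ℝ) {w : {v : V // v ≠ v₁}} (hw : w.1 ≠ v₀) :
    (Γ.glue v₀ v₁ hne α).cond w = VertexCondition.transport
      (κ := (Γ.glue v₀ v₁ hne α).EndsAt w) (fun b : Γ.EndsAt w.1 =>
        ⟨b.1, (congrArg (glueMap v₀ v₁ hne) b.2).trans (glueMap_coe v₀ v₁ hne w)⟩)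
      (Γ.cond w.1) :=
  if_neg hw

theorem isLagrangian_glue_cond (hv₀ : ∃ b, Γ.vert b = v₀) (α : ℝ)
    (h : ∀ v, v ≠ v₀ → v ≠ v₁ → (Γ.cond v).IsLagrangian) (w : {v : V // v ≠ v₁}) :
    ((Γ.glue v₀ v₁ hne α).cond w).IsLagrangian := by
  by_cases hw : w.1 = v₀
  · obtain rfl : w = ⟨v₀, hne⟩ := Subtype.ext hw
    rw [glue_cond_glued]
    obtain ⟨b, hb⟩ := hv₀
    have : Nonempty ((Γ.glue v₀ v₁ hne α).EndsAt ⟨v₀, hne⟩) :=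
      ⟨⟨b, (glueMap_eq_glued_iff hne _).2 (Or.inl hb)⟩⟩
    exact VertexCondition.isLagrangian_delta α
  · rw [glue_cond_of_ne Γ hne α hw]
    -- Away from the glued vertex the set of edge ends is unchanged, so the condition is carried
    -- over along a bijection.
    refine (h w.1 hw w.2).transport ⟨fun b c hbc => ?_, fun b => ?_⟩
    · exact Subtype.ext (congrArg (fun z : (Γ.glue v₀ v₁ hne α).EndsAt w => z.1) hbc)
    · exact ⟨⟨b.1, eq_of_glueMap_eq hne hw b.2⟩, rfl⟩

theorem sum_endsAt (v : V) (F : E × Bool → ℂ) :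
    ∑ b : Γ.EndsAt v, F b = ∑ b with Γ.vert b = v, F b :=
  (Finset.sum_subtype _ (by simp) F).symm

theorem sum_endsAt_glued (α : ℝ) (F : E × Bool → ℂ) :
    ∑ b : (Γ.glue v₀ v₁ hne α).EndsAt ⟨v₀, hne⟩, F b =
      (∑ b : Γ.EndsAt v₀, F b) + ∑ b : Γ.EndsAt v₁, F b := by
  classical
  rw [sum_endsAt, sum_endsAt, sum_endsAt, ← Finset.sum_union]
  · refine Finset.sum_congr ?_ fun _ _ => rfl
    ext b
    simp only [Finset.mem_filter, Finset.mem_univ, true_and, Finset.mem_union]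
    exact glueMap_eq_glued_iff hne _
  · rw [Finset.disjoint_filter]
    intro b _ h0 h1
    exact hne (h0.symm.trans h1)

variable {Γ} {α₀ α₁ : ℝ}

theorem mem_boundary_iff (h₀ : Γ.cond v₀ = VertexCondition.delta (Γ.EndsAt v₀) α₀)
    (h₁ : Γ.cond v₁ = VertexCondition.delta (Γ.EndsAt v₁) α₁)
    {x : (E × Bool → ℂ) × (E × Bool → ℂ)} : x ∈ Γ.boundary ↔
      (∀ v, v ≠ v₀ → v ≠ v₁ →
        ((fun b : Γ.EndsAt v => x.1 b), fun b : Γ.EndsAt v => x.2 b) ∈ Γ.cond v) ∧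
      ((∀ b c : Γ.EndsAt v₀, x.1 b = x.1 c) ∧
        ∀ b : Γ.EndsAt v₀, ∑ c : Γ.EndsAt v₀, x.2 c = (α₀ : ℂ) * x.1 b) ∧
      (∀ b c : Γ.EndsAt v₁, x.1 b = x.1 c) ∧
        ∀ b : Γ.EndsAt v₁, ∑ c : Γ.EndsAt v₁, x.2 c = (α₁ : ℂ) * x.1 b := by
  rw [mem_boundary]
  constructor
  · intro h
    have k₀ := h v₀
    have k₁ := h v₁
    rw [h₀, VertexCondition.mem_delta] at k₀
    rw [h₁, VertexCondition.mem_delta] at k₁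
    exact ⟨fun v _ _ => h v, k₀, k₁⟩
  · rintro ⟨h, k₀, k₁⟩ v
    by_cases hv₀ : v = v₀
    · subst hv₀
      rw [h₀, VertexCondition.mem_delta]
      exact k₀
    by_cases hv₁ : v = v₁
    · subst hv₁
      rw [h₁, VertexCondition.mem_delta]
      exact k₁
    exact h v hv₀ hv₁

theorem mem_boundary_glue_iff {α : ℝ} {x : (E × Bool → ℂ) × (E × Bool → ℂ)} :
    x ∈ (Γ.glue v₀ v₁ hne α).boundary ↔
      (∀ v, v ≠ v₀ → v ≠ v₁ →
        ((fun b : Γ.EndsAt v => x.1 b), fun b : Γ.EndsAt v => x.2 b) ∈ Γ.cond v) ∧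
      (∀ b c, (Γ.vert b = v₀ ∨ Γ.vert b = v₁) → (Γ.vert c = v₀ ∨ Γ.vert c = v₁) →
        x.1 b = x.1 c) ∧
      ∀ b, (Γ.vert b = v₀ ∨ Γ.vert b = v₁) →
        (∑ c : Γ.EndsAt v₀, x.2 c) + ∑ c : Γ.EndsAt v₁, x.2 c = (α : ℂ) * x.1 b := by
  rw [mem_boundary]
  constructor
  · intro h
    have k := h ⟨v₀, hne⟩
    rw [glue_cond_glued, VertexCondition.mem_delta] at k
    refine ⟨fun v hv₀ hv₁ => ?_, fun b c hb hc => ?_, fun b hb => ?_⟩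
    · have k' := h ⟨v, hv₁⟩
      rw [glue_cond_of_ne Γ hne α hv₀] at k'
      exact k'
    · exact k.1 ⟨b, (glueMap_eq_glued_iff hne _).2 hb⟩ ⟨c, (glueMap_eq_glued_iff hne _).2 hc⟩
    · rw [← Γ.sum_endsAt_glued hne α]
      exact k.2 ⟨b, (glueMap_eq_glued_iff hne _).2 hb⟩
  · rintro ⟨h, k, k'⟩ w
    by_cases hw : w.1 = v₀
    · obtain rfl : w = ⟨v₀, hne⟩ := Subtype.ext hw
      rw [glue_cond_glued, VertexCondition.mem_delta]
      refine ⟨fun b c => k _ _ ((glueMap_eq_glued_iff hne _).1 b.2)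
        ((glueMap_eq_glued_iff hne _).1 c.2), fun b => ?_⟩
      have := k' b ((glueMap_eq_glued_iff hne _).1 b.2)
      rw [← Γ.sum_endsAt_glued hne α] at this
      exact this
    · rw [glue_cond_of_ne Γ hne α hw]
      exact h w.1 hw w.2

/-- The boundary values admitted by the glued graph are admitted by the original one, with the
same boundary form. -/
theorem exists_mem_boundary_of_mem_glue (hv₀ : ∃ b, Γ.vert b = v₀) (hv₁ : ∃ b, Γ.vert b = v₁)
    (h₀ : Γ.cond v₀ = VertexCondition.delta (Γ.EndsAt v₀) α₀)
    (h₁ : Γ.cond v₁ = VertexCondition.delta (Γ.EndsAt v₁) α₁)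
    {x : (E × Bool → ℂ) × (E × Bool → ℂ)}
    (hx : x ∈ (Γ.glue v₀ v₁ hne (α₀ + α₁)).boundary) :
    ∃ F', (x.1, F') ∈ Γ.boundary ∧
      ∑ b, F' b * conj (x.1 b) = ∑ b, x.2 b * conj (x.1 b) := by
  classical
  obtain ⟨b₀, hb₀⟩ := hv₀
  obtain ⟨b₁, hb₁⟩ := hv₁
  obtain ⟨hx, hc, hs⟩ := (mem_boundary_glue_iff hne).1 hx
  -- `τ` is the defect in the derivative condition at `v₀`. Adding it at `b₀` and subtracting it at
  -- `b₁` repairs both vertices, since the total derivative is right for `α₀ + α₁`; the boundary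
  -- form is unaffected because the values at `b₀` and `b₁` agree.
  set τ : ℂ := (α₀ : ℂ) * x.1 b₀ - ∑ c : Γ.EndsAt v₀, x.2 c with hτ
  let d : E × Bool → ℂ := Pi.single b₀ τ - Pi.single b₁ τ
  have hb₀₁ : Γ.vert b₀ ≠ v₁ := fun h => hne (hb₀.symm.trans h)
  have hb₁₀ : Γ.vert b₁ ≠ v₀ := fun h => hne (h.symm.trans hb₁)
  have hd : ∀ b, Γ.vert b ≠ v₀ → Γ.vert b ≠ v₁ → d b = 0 := by
    intro b hb hb'
    have e0 : b ≠ b₀ := fun h => hb (h ▸ hb₀)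
    have e1 : b ≠ b₁ := fun h => hb' (h ▸ hb₁)
    simp [d, e0, e1]
  have hd₀ : ∑ c : Γ.EndsAt v₀, d c = τ := by
    rw [sum_endsAt]
    simp [d, Finset.sum_sub_distrib, hb₀, hb₁₀]
  have hd₁ : ∑ c : Γ.EndsAt v₁, d c = -τ := by
    rw [sum_endsAt]
    simp [d, Finset.sum_sub_distrib, hb₁, hb₀₁]
  have hx01 : x.1 b₁ = x.1 b₀ := hc _ _ (Or.inr hb₁) (Or.inl hb₀)
  refine ⟨x.2 + d, (mem_boundary_iff h₀ h₁).2 ⟨fun v hv hv' => ?_, ⟨fun b c => ?_, fun b => ?_⟩,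
    fun b c => ?_, fun b => ?_⟩, ?_⟩
  · convert hx v hv hv' using 2
    funext b
    simp [hd b (by rw [b.2]; exact hv) (by rw [b.2]; exact hv')]
  · exact hc _ _ (Or.inl b.2) (Or.inl c.2)
  · simp only [Pi.add_apply, Finset.sum_add_distrib, hd₀]
    rw [hc b b₀ (Or.inl b.2) (Or.inl hb₀), hτ]
    ring
  · exact hc _ _ (Or.inr b.2) (Or.inr c.2)
  · simp only [Pi.add_apply, Finset.sum_add_distrib, hd₁]
    have := hs b₀ (Or.inl hb₀)
    rw [hc b b₀ (Or.inr b.2) (Or.inl hb₀), hτ]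
    push_cast at this
    linear_combination this
  · have : ∑ b, d b * conj (x.1 b) = 0 := by
      simp [d, sub_mul, Finset.sum_sub_distrib, Pi.single_apply, ite_mul, hx01]
    simp only [Pi.add_apply, add_mul, Finset.sum_add_distrib, this, add_zero]

/-- A single linear condition on the boundary values of the original graph leads to the glued
graph. -/
theorem mem_boundary_glue_of_mem_boundary {b₀ b₁ : E × Bool} (hb₀ : Γ.vert b₀ = v₀)
    (hb₁ : Γ.vert b₁ = v₁) (h₀ : Γ.cond v₀ = VertexCondition.delta (Γ.EndsAt v₀) α₀)
    (h₁ : Γ.cond v₁ = VertexCondition.delta (Γ.EndsAt v₁) α₁)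
    {x : (E × Bool → ℂ) × (E × Bool → ℂ)} (hx : x ∈ Γ.boundary) (h : x.1 b₀ = x.1 b₁) :
    x ∈ (Γ.glue v₀ v₁ hne (α₀ + α₁)).boundary := by
  obtain ⟨hx, ⟨k₀, s₀⟩, k₁, s₁⟩ := (mem_boundary_iff h₀ h₁).1 hx
  have key : ∀ b, (Γ.vert b = v₀ ∨ Γ.vert b = v₁) → x.1 b = x.1 b₀ := by
    rintro b (hb | hb)
    · exact k₀ ⟨b, hb⟩ ⟨b₀, hb₀⟩
    · exact (k₁ ⟨b, hb⟩ ⟨b₁, hb₁⟩).trans h.symm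
  refine (mem_boundary_glue_iff hne).2 ⟨hx, fun b c hb hc => (key b hb).trans (key c hc).symm,
    fun b hb => ?_⟩
  rw [s₀ ⟨b₀, hb₀⟩, s₁ ⟨b₁, hb₁⟩, key b hb, ← h]
  push_cast
  ring

end QuantumGraph

end

/-! ### The interlacing inequalities. -/

theorem theorem5p3 {V E : Type*} [Finite V] [DecidableEq V] [Fintype E]
    (Γ : QuantumGraph V E) (v₀ v₁ : V) (hne : v₀ ≠ v₁)
    (hv₀ : ∃ b, Γ.vert b = v₀) (hv₁ : ∃ b, Γ.vert b = v₁) (α₀ α₁ : ℝ)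
    (h₀ : Γ.cond v₀ = VertexCondition.delta (Γ.EndsAt v₀) α₀)
    (h₁ : Γ.cond v₁ = VertexCondition.delta (Γ.EndsAt v₁) α₁)
    (hsa : ∀ v, v ≠ v₀ → v ≠ v₁ → (Γ.cond v).IsSelfAdjoint) :
    (∃ l, Γ.IsEigenvalueSequence l) ∧
    (∃ l', (Γ.glue v₀ v₁ hne (α₀ + α₁)).IsEigenvalueSequence l') ∧
    ∀ l l' : ℕ → ℝ, Γ.IsEigenvalueSequence l →
      (Γ.glue v₀ v₁ hne (α₀ + α₁)).IsEigenvalueSequence l' →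
      ∀ n, l n ≤ l' n ∧ l' n ≤ l (n + 1) := by
  obtain ⟨b₀, hb₀⟩ := hv₀
  obtain ⟨b₁, hb₁⟩ := hv₁
  have : Nonempty E := ⟨b₀.1⟩
  have hlag : ∀ v, v ≠ v₀ → v ≠ v₁ → (Γ.cond v).IsLagrangian :=
    fun v hv hv' => (hsa v hv hv').isLagrangian
  have hM : Γ.boundary.IsLagrangian := QuantumGraph.isLagrangian_boundary fun v => by
    by_cases hv : v = v₀
    · subst hv
      have : Nonempty (Γ.EndsAt v) := ⟨⟨b₀, hb₀⟩⟩
      rw [h₀]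
      exact VertexCondition.isLagrangian_delta α₀
    by_cases hv' : v = v₁
    · subst hv'
      have : Nonempty (Γ.EndsAt v) := ⟨⟨b₁, hb₁⟩⟩
      rw [h₁]
      exact VertexCondition.isLagrangian_delta α₁
    exact hlag v hv hv'
  have hM' : (Γ.glue v₀ v₁ hne (α₀ + α₁)).boundary.IsLagrangian :=
    QuantumGraph.isLagrangian_boundary
      (Γ.isLagrangian_glue_cond hne ⟨b₀, hb₀⟩ (α₀ + α₁) hlag)
  -- Gluing leaves edges and potentials unchanged: both Hamiltonians live on the same `X` and differ
  -- only in their boundary conditions.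
  let X := Γ.toMetricEdges
  obtain ⟨c, hc⟩ := X.exists_isPositiveShift hM.1
  obtain ⟨c', hc'⟩ := X.exists_isPositiveShift hM'.1
  -- A common shift is needed, since the two resolvents are compared at the same point.
  have hk := hc (max c c') (le_max_left _ _)
  have hk' := hc' (max c c') (le_max_right _ _)
  obtain ⟨S, hS⟩ := X.exists_isSolutionOperator hM hk
  obtain ⟨S', hS'⟩ := X.exists_isSolutionOperator hM' hk'
  have hR := hS.isPositiveResolvent hM.1 hk
  have hR' := hS'.isPositiveResolvent hM'.1 hk'
  have hiff := Γ.isEigenvalueSequence_iff hS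
  have hiff' : ∀ l', (Γ.glue v₀ v₁ hne (α₀ + α₁)).IsEigenvalueSequence l' ↔
      IsShiftedEigenvalueSequence (X.toL2.comp S') (max c c') l' :=
    (Γ.glue v₀ v₁ hne (α₀ + α₁)).isEigenvalueSequence_iff hS'
  have hinf := X.not_finiteDimensional_L2
  refine ⟨?_, ?_, fun l l' hl hl' n => ?_⟩
  · obtain ⟨l, hl⟩ := hR.exists_isShiftedEigenvalueSequence hinf (max c c')
    exact ⟨l, (hiff l).2 hl⟩
  · obtain ⟨l, hl⟩ := hR'.exists_isShiftedEigenvalueSequence hinf (max c c')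
    exact ⟨l, (hiff' l).2 hl⟩
  -- `φ g` is the difference of the values at `v₀` and `v₁` of the solution on `Γ` with right-hand
  -- side `g`; where it vanishes, this solution also solves the problem on the glued graph.
  · let φ : X.L2 →ₗ[ℂ] ℂ :=
      (LinearMap.proj (R := ℂ) (φ := fun _ : E × Bool => ℂ) b₀ -
        LinearMap.proj (R := ℂ) (φ := fun _ : E × Bool => ℂ) b₁).comp
        ((X.val.comp S : X.L2 →L[ℂ] (E × Bool → ℂ)) : X.L2 →ₗ[ℂ] (E × Bool → ℂ))
    refine hR.interlacing hR' (hS.re_inner_le hS' hM.1 hk fun x hx => ?_) φ (fun g hg => ?_)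
      ((hiff l).1 hl) ((hiff' l').1 hl') n
    · exact QuantumGraph.exists_mem_boundary_of_mem_glue hne ⟨b₀, hb₀⟩ ⟨b₁, hb₁⟩ h₀ h₁ hx
    · have hmem := QuantumGraph.mem_boundary_glue_of_mem_boundary hne hb₀ hb₁ h₀ h₁
        (hS.trace_mem g) (sub_eq_zero.1 hg)
      exact congrArg X.toL2 (hS.eq_of_trace_mem hS' hmem)
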